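/- \textbf{Theorem (Superposition coding inner bound).} A classical-quantum broadcast channel with finite input alphabet $\mathcal{X}$ assigns to each $x\in\mathcal{X}$ a density operator $\rho_x^{B_1B_2}$ on a tensor product $\mathcal{H}^{B_1}\otimes\mathcal{H}^{B_2}$ of finite-dimensional Hilbert spaces. For $x^n\in\mathcal{X}^n$ write $\rho_{x^n}^{B_1^nB_2^n}=\rho_{x_1}^{B_1B_2}\otimes\cdots\otimes\rho_{x_n}^{B_1B_2}$. An $(n,R_1,R,R_2,\epsilon)$ code consists of message sets $\mathcal{M}_1,\mathcal{M},\mathcal{M}_2$ with $\lceil 2^{nR_1}\rceil$, $\lceil 2^{nR}\rceil$ and $\lceil 2^{nR_2}\rceil$ elements, codewords $x^n(m_1,m,m_2)\in\mathcal{X}^n$, a POVM $\{\Lambda_{m_1,m}\}$ on $B_1^n$ with which Receiver 1 decodes the pair $(m_1,m)$ in one joint measurement, and a POVM $\{\Gamma_{m,m_2}\}$ on $B_2^n$ with which Receiver 2 decodes $(m,m_2)$, such that $$\frac{1}{|\mathcal{M}_1||\mathcal{M}||\mathcal{M}_2|}\sum_{m_1,m,m_2}\mathrm{Tr}\Big[\big(I-\Lambda_{m_1,m}\otimes\Gamma_{m,m_2}\big)\,\rho_{x^n(m_1,m,m_2)}^{B_1^nB_2^n}\Big]\le\epsilon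 .$$ A rate triple $(R_1,R,R_2)$ is achievable if for all $\epsilon,\delta>0$ and all sufficiently large $n$ there is an $(n,R_1-\delta,R-\delta,R_2-\delta,\epsilon)$ code. Let $W$ be an auxiliary random variable with values in a finite set and distribution $p_W$, let $p_{X|W}$ be a conditional distribution on $\mathcal{X}$, and let $$\theta^{WXB_1B_2}=\sum_{w,x}p_W(w)\,p_{X|W}(x|w)\,|w\rangle\langle w|^W\otimes|x\rangle\langle x|^X\otimes\rho_x^{B_1B_2}.$$ Then for every pair of rates $R_1\ge 0$, $R\ge 0$ with $$R_1\le I(X;B_1|W)_\theta,\qquad R\le I(W;B_2)_\theta,\qquad R_1+R\le I(X;B_1)_\theta ,$$ the triple $(R_1,R,0)$ is achievable: a personal message for Receiver 1 can be sent at rate $R_1$ and a common message for both receivers at rate $R$, with no personal message for Receiver 2. Here $I(A;B)=H(A)+H(B)-H(AB)$ and $I(A;B|C)=H(AC)+H(BC)-H(ABC)-H(C)$, where $H(\rho)=-\mathrm{Tr}(\rho\log_2\rho)$ is the von Neumann entropy of the corresponding reduced state. -/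

import Mathlib

open scoped Kronecker ComplexOrder

noncomputable section

namespace CQBroadcast

/-- A density operator on the Hilbert space `ℂ^d` (basis indexed by `d`). -/
def IsDensity {d : Type*} [Fintype d] (ρ : Matrix d d ℂ) : Prop :=
  ρ.PosSemidef ∧ ρ.trace = 1

/-- A positive operator-valued measure on `ℂ^d` with outcomes in `M`. -/
def IsPOVM {M d : Type*} [Fintype M] [DecidableEq d] (Λ : M → Matrix d d ℂ) : Prop :=
  (∀ m, (Λ m).PosSemidef) ∧ ∑ m, Λ m = 1

/-- Partial trace. The basis of the whole system is indexed by `S`, that of the retained subsystem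
by `T` and that of the subsystem traced out by `E`; `f t e` is the index in `S` of the product
vector `|t⟩ ⊗ |e⟩`. -/
def partialTrace {S T E : Type*} [Fintype E] (f : T → E → S) (ρ : Matrix S S ℂ) :
    Matrix T T ℂ :=
  Matrix.of fun i j => ∑ e, ρ (f i e) (f j e)

/-- The von Neumann entropy `H(ρ) = - Tr (ρ log₂ ρ)`, in bits; the logarithm of `ρ` is taken by
functional calculus on the eigenvalues, and `0 log 0 = 0`. -/
def entropy {d : Type*} [Fintype d] [DecidableEq d] (ρ : Matrix d d ℂ) : ℝ :=
  -(ρ * cfc (Real.logb 2) ρ).trace.re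

/-- The mutual information `I(A;B) = H(A) + H(B) - H(AB)` of a state on `AB`. -/
def mutualInfo {a b : Type*} [Fintype a] [DecidableEq a] [Fintype b] [DecidableEq b]
    (ρ : Matrix (a × b) (a × b) ℂ) : ℝ :=
  entropy (partialTrace (fun (i : a) (k : b) => (i, k)) ρ)
    + entropy (partialTrace (fun (i : b) (k : a) => (k, i)) ρ)
    - entropy ρ

/-- The conditional mutual information `I(A;B|C) = H(AC) + H(BC) - H(ABC) - H(C)` of a state
on `ABC`. -/
def condMutualInfo {a b c : Type*} [Fintype a] [DecidableEq a] [Fintype b] [DecidableEq b]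
    [Fintype c] [DecidableEq c] (ρ : Matrix (a × b × c) (a × b × c) ℂ) : ℝ :=
  entropy (partialTrace (fun (i : a × c) (k : b) => (i.1, k, i.2)) ρ)
    + entropy (partialTrace (fun (i : b × c) (k : a) => (k, i.1, i.2)) ρ)
    - entropy ρ
    - entropy (partialTrace (fun (i : c) (k : a × b) => (k.1, k.2, i)) ρ)

/-- A classical-quantum-quantum broadcast channel `x ↦ ρ_x^{B₁B₂}` with input alphabet `X` and
output Hilbert spaces `ℂ^{b₁}` and `ℂ^{b₂}`. -/
structure Channel (X b₁ b₂ : Type*) [Fintype b₁] [Fintype b₂] where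
  state : X → Matrix (b₁ × b₂) (b₁ × b₂) ℂ
  isDensity : ∀ x, IsDensity (state x)

variable {X W b₁ b₂ : Type*} [Fintype b₁] [DecidableEq b₁] [Fintype b₂] [DecidableEq b₂]

/-- The output `ρ_{x₁} ⊗ ⋯ ⊗ ρ_{xₙ}` of `n` uses of the channel on the input sequence `x`, as an
operator on `B₁ⁿ ⊗ B₂ⁿ`. -/
def Channel.output (N : Channel X b₁ b₂) {n : ℕ} (x : Fin n → X) :
    Matrix ((Fin n → b₁) × (Fin n → b₂)) ((Fin n → b₁) × (Fin n → b₂)) ℂ :=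
  Matrix.of fun i j => ∏ k, N.state (x k) (i.1 k, i.2 k) (j.1 k, j.2 k)

/-- A code of block length `n` with `M₁` personal messages for Receiver 1, `M` common messages and
`M₂` personal messages for Receiver 2: a codebook, a POVM on `B₁ⁿ` for Receiver 1 whose outcomes
are the pairs `(m₁, m)`, and a POVM on `B₂ⁿ` for Receiver 2 whose outcomes are the
pairs `(m, m₂)`. -/
structure Code (X b₁ b₂ : Type*) [Fintype b₁] [DecidableEq b₁] [Fintype b₂] [DecidableEq b₂]
    (n M₁ M M₂ : ℕ) where
  codeword : Fin M₁ → Fin M → Fin M₂ → (Fin n → X)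
  decoder₁ : Fin M₁ × Fin M → Matrix (Fin n → b₁) (Fin n → b₁) ℂ
  decoder₂ : Fin M × Fin M₂ → Matrix (Fin n → b₂) (Fin n → b₂) ℂ
  isPOVM₁ : IsPOVM decoder₁
  isPOVM₂ : IsPOVM decoder₂

/-- The probability that at least one receiver decodes incorrectly when `(m₁, m, m₂)` is sent. -/
def Code.error {n M₁ M M₂ : ℕ} (C : Code X b₁ b₂ n M₁ M M₂) (N : Channel X b₁ b₂)
    (m₁ : Fin M₁) (m : Fin M) (m₂ : Fin M₂) : ℝ :=
  ((1 - C.decoder₁ (m₁, m) ⊗ₖ C.decoder₂ (m, m₂)) * N.output (C.codeword m₁ m m₂)).trace.re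

/-- The error probability averaged over all message triples. -/
def Code.avgError {n M₁ M M₂ : ℕ} (C : Code X b₁ b₂ n M₁ M M₂) (N : Channel X b₁ b₂) : ℝ :=
  (∑ m₁, ∑ m, ∑ m₂, C.error N m₁ m m₂) / (M₁ * M * M₂)

/-- The number of messages at rate `R` and block length `n`, which is `2^{nR}` rounded up; it is
never zero. -/
def numMessages (n : ℕ) (R : ℝ) : ℕ := ⌈(2 : ℝ) ^ (n * R)⌉₊

/-- The rate triple `(R₁, R, R₂)` (personal message for Receiver 1, common message, personal
message for Receiver 2) is achievable: for all `ε, δ > 0` and all sufficiently large `n` there is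
an `(n, R₁ - δ, R - δ, R₂ - δ, ε)` code. -/
def Channel.Achievable (N : Channel X b₁ b₂) (R₁ R R₂ : ℝ) : Prop :=
  ∀ ε > (0 : ℝ), ∀ δ > (0 : ℝ), ∀ᶠ n : ℕ in Filter.atTop,
    ∃ C : Code X b₁ b₂ n (numMessages n (R₁ - δ)) (numMessages n (R - δ))
        (numMessages n (R₂ - δ)),
      C.avgError N ≤ ε

/-- The state `θ^{WXB₁B₂} = ∑ p_W(w) p_{X|W}(x|w) |w⟩⟨w| ⊗ |x⟩⟨x| ⊗ ρ_x^{B₁B₂}`. -/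
def codeState [Fintype W] [DecidableEq W] [Fintype X] [DecidableEq X] (N : Channel X b₁ b₂)
    (pW : W → ℝ) (pXW : W → X → ℝ) :
    Matrix (W × X × b₁ × b₂) (W × X × b₁ × b₂) ℂ :=
  ∑ w, ∑ x, ((pW w * pXW w x : ℝ) : ℂ) •
    (Matrix.single w w (1 : ℂ) ⊗ₖ (Matrix.single x x (1 : ℂ) ⊗ₖ N.state x))

/-- `I(X;B₁|W)` for a state on `WXB₁B₂`. -/
def infoXB₁W [Fintype W] [DecidableEq W] [Fintype X] [DecidableEq X]
    (θ : Matrix (W × X × b₁ × b₂) (W × X × b₁ × b₂) ℂ) : ℝ :=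
  condMutualInfo
    (partialTrace (fun (i : X × b₁ × W) (k : b₂) => (i.2.2, i.1, i.2.1, k)) θ)

/-- `I(W;B₂)` for a state on `WXB₁B₂`. -/
def infoWB₂ [Fintype W] [DecidableEq W] [Fintype X] [DecidableEq X]
    (θ : Matrix (W × X × b₁ × b₂) (W × X × b₁ × b₂) ℂ) : ℝ :=
  mutualInfo
    (partialTrace (fun (i : W × b₂) (k : X × b₁) => (i.1, k.1, k.2, i.2)) θ)

/-- `I(X;B₁)` for a state on `WXB₁B₂`. -/
def infoXB₁ [Fintype W] [DecidableEq W] [Fintype X] [DecidableEq X]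
    (θ : Matrix (W × X × b₁ × b₂) (W × X × b₁ × b₂) ℂ) : ℝ :=
  mutualInfo
    (partialTrace (fun (i : X × b₁) (k : W × b₂) => (k.1, i.1, i.2, k.2)) θ)

end CQBroadcast

end

/-! The code is a random superposition codebook: cloud centres `wⁿ` drawn from `p_W`, and satellites
`xⁿ` drawn around each from `p_{X|W}`. Receiver 1 applies one square-root measurement built from the
conditionally typical projections `S` of all satellites. Receiver 2 does the same with the typical
projections `T` of the averaged states of the clouds. A Hayashi–Nagaoka bound splits each error into
a miss of the right projection and the sum of the competing projections. Bounding the latter calls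
for a state with small operator norm. The measurement is left alone and the state is smoothed in the
analysis: `ρ` becomes `K ρ K†` with `K = P Q`, where `Q` is typical for the true cloud and `P` for
the overall average (`expect_error_le`). Averaging over the true satellite, a competitor in the same
cloud sees `P Q σ_w Q P ≤ c₁`. For a competitor in another cloud, `Q σ_w Q ≤ σ_w` first removes `Q`,
and averaging over `w` leaves `P τ P ≤ c₂`. One smoothing thus serves both kinds of competitor,
which makes joint decoding possible. For Receiver 2, `K = P'` suffices. Each competitor costs norm
times rank. By typicality this is about `2^(-n I(X;B₁|W))` in the same cloud, `2^(-n I(X;B₁))` in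
another one and `2^(-n I(W;B₂))` at Receiver 2, which gives the three rate conditions. The main
steps are `exists_povm_of_projections`, `eventually_exists_typical_projections`,
`exists_superposition_codebook` and `exists_one_shot_code`. -/

/-! ### Operator inequalities, the square-root measurement, and smoothing of states. -/

section Expectation
open scoped MatrixOrder
open Matrix

namespace CQBroadcast

variable {d : Type*} [Fintype d]

/-- The expectation `Re Tr (A ρ)` of the observable `A` in the state `ρ`. -/
noncomputable def expect (ρ A : Matrix d d ℂ) : ℝ := (A * ρ).trace.re

theorem expect_add (ρ A B : Matrix d d ℂ) : expect ρ (A + B) = expect ρ A + expect ρ B := by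
  simp [expect, add_mul]

theorem expect_sub (ρ A B : Matrix d d ℂ) : expect ρ (A - B) = expect ρ A - expect ρ B := by
  simp [expect, sub_mul]

theorem expect_smul (ρ : Matrix d d ℂ) (c : ℝ) (A : Matrix d d ℂ) :
    expect ρ (c • A) = c * expect ρ A := by
  simp [expect]

theorem expect_sum {ι : Type*} (ρ : Matrix d d ℂ) (s : Finset ι) (A : ι → Matrix d d ℂ) :
    expect ρ (∑ i ∈ s, A i) = ∑ i ∈ s, expect ρ (A i) := by
  simp [expect, Finset.sum_mul, trace_sum]

theorem expect_comm (ρ A : Matrix d d ℂ) : expect ρ A = expect A ρ := by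
  rw [expect, expect, trace_mul_comm]

theorem expect_sum_smul_left {ι : Type*} [Fintype ι] (p : ι → ℝ) (ρ : ι → Matrix d d ℂ)
    (A : Matrix d d ℂ) : expect (∑ i, p i • ρ i) A = ∑ i, p i * expect (ρ i) A := by
  rw [expect_comm, expect_sum]
  exact Finset.sum_congr rfl fun i _ => by rw [expect_smul, expect_comm]

theorem expect_conj (ρ A K : Matrix d d ℂ) : expect (K * ρ * Kᴴ) A = expect ρ (Kᴴ * A * K) := by
  rw [expect, expect, ← mul_assoc, trace_mul_comm]
  simp only [mul_assoc]

theorem expect_nonneg {ρ A : Matrix d d ℂ} (hρ : ρ.PosSemidef) (hA : A.PosSemidef) :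
    0 ≤ expect ρ A := by
  classical
  obtain ⟨B, rfl⟩ := CStarAlgebra.nonneg_iff_eq_star_mul_self.mp hρ.nonneg
  have h : (A * (star B * B)).trace = (B * A * Bᴴ).trace := by
    rw [← mul_assoc, trace_mul_comm, star_eq_conjTranspose, mul_assoc]
  rw [expect, h]
  exact (Complex.le_def.1 (hA.mul_mul_conjTranspose_same B).trace_nonneg).1

theorem expect_mono {ρ A B : Matrix d d ℂ} (hρ : ρ.PosSemidef) (h : A ≤ B) :
    expect ρ A ≤ expect ρ B := by
  have := expect_nonneg hρ h
  rw [expect_sub] at this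
  linarith

theorem expect_mono_left {ρ σ A : Matrix d d ℂ} (hA : A.PosSemidef) (h : ρ ≤ σ) :
    expect ρ A ≤ expect σ A := by
  rw [expect_comm ρ, expect_comm σ]
  exact expect_mono hA h

omit [Fintype d] in
theorem le_of_sub_eq_posSemidef {A B C : Matrix d d ℂ} (hC : C.PosSemidef) (h : B - A = C) :
    A ≤ B := by
  rw [Matrix.le_iff, h]
  exact hC

/-- Parallelogram law: the difference of the two sides is `(X - Y)ᴴ A (X - Y)`. -/
theorem conj_add_le_two_smul {A : Matrix d d ℂ} (hA : A.PosSemidef) (X Y : Matrix d d ℂ) :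
    (X + Y)ᴴ * A * (X + Y) ≤ (2 : ℝ) • (Xᴴ * A * X) + (2 : ℝ) • (Yᴴ * A * Y) := by
  have h := hA.conjTranspose_mul_mul_same (X - Y)
  refine le_of_sub_eq_posSemidef h ?_
  simp only [conjTranspose_add, conjTranspose_sub, two_smul]
  noncomm_ring

theorem posSemidef_of_projection {S : Matrix d d ℂ} (hS : S.IsHermitian) (hS2 : S * S = S) :
    S.PosSemidef := by
  have := posSemidef_conjTranspose_mul_self S
  rwa [hS.eq, hS2] at this

variable [DecidableEq d]

theorem projection_one_sub {S : Matrix d d ℂ} (hS2 : S * S = S) : (1 - S) * (1 - S) = 1 - S := by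
  rw [sub_mul, mul_sub, mul_sub, hS2]; simp

theorem posSemidef_one_sub_projection {S : Matrix d d ℂ} (hS : S.IsHermitian) (hS2 : S * S = S) :
    (1 - S).PosSemidef :=
  posSemidef_of_projection (isHermitian_one.sub hS) (projection_one_sub hS2)

open scoped Matrix.Norms.L2Operator in
-- A projection is its own square root, and the square root is operator monotone.
theorem projection_le_sqrt {S A : Matrix d d ℂ} (hS : S.PosSemidef) (hS2 : S * S = S)
    (h : S ≤ A) : S ≤ CFC.sqrt A := by
  have h1 : CFC.sqrt S = S := CFC.sqrt_unique hS2 hS.nonneg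
  rw [← h1]
  exact CFC.sqrt_le_sqrt _ _ h

/-- A Hayashi–Nagaoka inequality: for a projection `S` and `A = S + T` with inverse square root
`B`, the square-root measurement operator `B S B` satisfies `1 - B S B ≤ 2 (1 - S) + 4 T`. -/
theorem one_sub_sqrt_measurement_le {S T R B : Matrix d d ℂ} (hS : S.IsHermitian)
    (hS2 : S * S = S) (hT : T.PosSemidef) (hR : R = CFC.sqrt (S + T)) (hB : B.IsHermitian)
    (hBR : B * R = 1) (hRB : R * B = 1) :
    1 - B * S * B ≤ (2 : ℝ) • (1 - S) + (4 : ℝ) • T := by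
  have hSp := posSemidef_of_projection hS hS2
  have hA : 0 ≤ S + T := (hSp.add hT).nonneg
  have hRR : R * R = S + T := by rw [hR, CFC.sqrt_mul_sqrt_self _ hA]
  have hSR : S ≤ R := by
    rw [hR]
    exact projection_le_sqrt hSp hS2 (by simpa using hT.nonneg)
  have hBAB : B * (S + T) * B = 1 := by
    rw [← hRR, ← mul_assoc, hBR, one_mul, hRB]
  -- Since `B (S + T) B = 1`, the error operator is `B T B`. Writing `B = 1 + (B - 1)` splits it
  -- into `2 T` and `2 (B - 1) T (B - 1)`.
  have e1 : 1 - B * S * B = (1 + (B - 1))ᴴ * T * (1 + (B - 1)) := by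
    rw [add_sub_cancel, hB.eq, ← hBAB]; noncomm_ring
  have e2 : (B - 1)ᴴ * T * (B - 1) ≤ (B - 1)ᴴ * (S + T) * (B - 1) := by
    have := hSp.conjTranspose_mul_mul_same (B - 1)
    refine le_of_sub_eq_posSemidef this ?_
    noncomm_ring
  have e3 : (B - 1)ᴴ * (S + T) * (B - 1) = 1 - (2 : ℝ) • R + (S + T) := by
    rw [conjTranspose_sub, hB.eq, conjTranspose_one, ← hRR,
      show (B - 1) * (R * R) * (B - 1) = (B * R - R) * (R * B - R) by noncomm_ring, hBR, hRB,
      two_smul]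
    noncomm_ring
  have e4 := conj_add_le_two_smul hT 1 (B - 1)
  rw [← e1] at e4
  -- Enlarging `T` to `S + T = R²` gives `(1 - R)² = 1 - 2R + S + T`, and `S ≤ R` turns this into `1
  -- - S + T`.
  have e5 : (B - 1)ᴴ * T * (B - 1) ≤ 1 - S + T := by
    refine e2.trans ?_
    rw [e3]
    have h2 : (R - S).PosSemidef := hSR
    refine le_of_sub_eq_posSemidef (h2.add h2) ?_
    rw [two_smul]; abel
  refine e4.trans ?_
  have h5 : (1 - S + T - (B - 1)ᴴ * T * (B - 1)).PosSemidef := e5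
  refine le_of_sub_eq_posSemidef (h5.add h5) ?_
  simp only [conjTranspose_one, one_mul, mul_one, two_smul,
    show (4 : ℝ) = 1 + 1 + 1 + 1 by norm_num, add_smul, one_smul]
  abel

/-- Square-root measurement for a family of projections, with its error bound. -/
theorem exists_povm_of_projections {ι : Type*} [Fintype ι] [DecidableEq ι] [Nonempty ι]
    (S : ι → Matrix d d ℂ) (hS : ∀ i, (S i).IsHermitian) (hS2 : ∀ i, S i * S i = S i)
    {η : ℝ} (hη : 0 < η) :
    ∃ Λ : ι → Matrix d d ℂ, IsPOVM Λ ∧ ∀ i,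
      -- The term `η • 1` makes the sum of the projections invertible.
      1 - Λ i ≤ (2 : ℝ) • (1 - S i) + (4 : ℝ) • (∑ j ∈ Finset.univ.erase i, S j + η • 1) := by
  have hSp := fun i => posSemidef_of_projection (hS i) (hS2 i)
  have hηp : (η • (1 : Matrix d d ℂ)).PosDef := PosDef.one.smul hη
  set A : Matrix d d ℂ := ∑ j, S j + η • 1 with hA
  have hAp : A.PosDef := PosDef.posSemidef_add (posSemidef_sum _ fun i _ => hSp i) hηp
  set R := CFC.sqrt A with hR
  have hRu : IsUnit R := (CFC.isUnit_sqrt_iff A hAp.posSemidef.nonneg).2 hAp.isUnit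
  have hRp : R.PosSemidef := (CFC.sqrt_nonneg A).posSemidef
  have hRd : IsUnit R.det := (isUnit_iff_isUnit_det R).1 hRu
  have hRR : R * R = A := CFC.sqrt_mul_sqrt_self A hAp.posSemidef.nonneg
  have hB : (R⁻¹).IsHermitian := hRp.1.inv
  have hBR := nonsing_inv_mul R hRd
  have hRB := mul_nonsing_inv R hRd
  generalize R⁻¹ = B at hB hBR hRB
  have conj_pos : ∀ T : Matrix d d ℂ, T.PosSemidef → (B * T * B).PosSemidef := fun T hT => by
    have := hT.conjTranspose_mul_mul_same B
    rwa [hB.eq] at this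
  have hEp : (B * (η • 1) * B).PosSemidef := conj_pos _ hηp.posSemidef
  -- The operators `B S i B` sum to `1 - η B²`. The missing part is given to an arbitrary outcome,
  -- whose error this can only reduce.
  let i₀ := Classical.arbitrary ι
  refine ⟨fun i => B * S i * B + if i = i₀ then B * (η • 1) * B else 0, ⟨fun i => ?_, ?_⟩,
    fun i => ?_⟩
  · refine (conj_pos _ (hSp i)).add ?_
    split_ifs
    exacts [hEp, .zero]
  · rw [Finset.sum_add_distrib, Finset.sum_ite_eq' Finset.univ i₀, if_pos (Finset.mem_univ _),
      ← Finset.sum_mul, ← Finset.mul_sum, ← add_mul, ← mul_add, ← hA, ← hRR, ← mul_assoc, hBR,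
      one_mul, hRB]
  · have hT : (∑ j ∈ Finset.univ.erase i, S j + η • (1 : Matrix d d ℂ)).PosSemidef :=
      (posSemidef_sum _ fun i _ => hSp i).add hηp.posSemidef
    have hAi : A = S i + (∑ j ∈ Finset.univ.erase i, S j + η • 1) := by
      rw [hA, ← Finset.add_sum_erase _ _ (Finset.mem_univ i), add_assoc]
    refine le_trans ?_
      (one_sub_sqrt_measurement_le (hS i) (hS2 i) hT (by rw [hR, hAi]) hB hBR hRB)
    by_cases hi : i = i₀
    · refine le_of_sub_eq_posSemidef hEp ?_
      simp only [hi, if_true]; abel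
    · simp [hi]

/-- Error of a measurement operator in terms of its error on the smoothed state `K ρ Kᴴ`. -/
theorem expect_le_of_smoothing {ρ A : Matrix d d ℂ} (hρ : ρ.PosSemidef) (hA : A.PosSemidef)
    (hA1 : A ≤ 1) (K : Matrix d d ℂ) :
    expect ρ A ≤ 2 * expect (K * ρ * Kᴴ) A + 2 * expect ρ ((1 - K)ᴴ * (1 - K)) := by
  have h1 := expect_mono hρ (conj_add_le_two_smul hA K (1 - K))
  rw [add_sub_cancel, conjTranspose_one, one_mul, mul_one, expect_add, expect_smul, expect_smul]
    at h1
  have h2 : (1 - K)ᴴ * A * (1 - K) ≤ (1 - K)ᴴ * (1 - K) := by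
    have h3 : (1 - A).PosSemidef := hA1
    have := h3.conjTranspose_mul_mul_same (1 - K)
    refine le_of_sub_eq_posSemidef this ?_
    noncomm_ring
  have h3 := expect_mono hρ h2
  rw [expect_conj]
  linarith

/-- Smoothing in the reverse direction, by the splitting `K = 1 + (K - 1)`. It brings the term `1 -
S` back from the smoothed state to `ρ`. -/
theorem expect_conj_le_of_smoothing {ρ A : Matrix d d ℂ} (hρ : ρ.PosSemidef) (hA : A.PosSemidef)
    (hA1 : A ≤ 1) (K : Matrix d d ℂ) :
    expect (K * ρ * Kᴴ) A ≤ 2 * expect ρ A + 2 * expect ρ ((1 - K)ᴴ * (1 - K)) := by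
  have h1 := expect_mono hρ (conj_add_le_two_smul hA 1 (K - 1))
  rw [add_sub_cancel, conjTranspose_one, one_mul, mul_one, expect_add, expect_smul, expect_smul]
    at h1
  have h2 : (K - 1)ᴴ * A * (K - 1) ≤ (1 - K)ᴴ * (1 - K) := by
    have h3 : (1 - A).PosSemidef := hA1
    have := h3.conjTranspose_mul_mul_same (1 - K)
    refine le_of_sub_eq_posSemidef this ?_
    simp only [conjTranspose_sub]
    noncomm_ring
  have h3 := expect_mono hρ h2
  rw [expect_conj]
  linarith

/-- The defect of smoothing by a product of two projections. -/
theorem expect_smoothing_defect_le {ρ P Q : Matrix d d ℂ} (hρ : ρ.PosSemidef)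
    (hP : P.IsHermitian) (hP2 : P * P = P) (hQ : Q.IsHermitian) (hQ2 : Q * Q = Q) :
    expect ρ ((1 - P * Q)ᴴ * (1 - P * Q)) ≤ 2 * expect ρ (1 - P) + 2 * expect ρ (1 - Q) := by
  have h1 := expect_mono hρ (conj_add_le_two_smul PosSemidef.one (1 - P) (P * (1 - Q)))
  have e : 1 - P + P * (1 - Q) = 1 - P * Q := by noncomm_ring
  have e1 : (1 - P)ᴴ * 1 * (1 - P) = 1 - P := by
    rw [mul_one, conjTranspose_sub, hP.eq, conjTranspose_one, projection_one_sub hP2]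
  have e2 : (P * (1 - Q))ᴴ * 1 * (P * (1 - Q)) ≤ 1 - Q := by
    have h3 := (posSemidef_one_sub_projection hP hP2).conjTranspose_mul_mul_same (1 - Q)
    refine le_of_sub_eq_posSemidef (h3) ?_
    rw [conjTranspose_mul, hP.eq, mul_one, conjTranspose_sub, hQ.eq, conjTranspose_one,
      show (1 - Q) * P * (P * (1 - Q)) = (1 - Q) * (P * P) * (1 - Q) by noncomm_ring, hP2,
      mul_sub (1 - Q) 1 P, sub_mul _ _ (1 - Q), mul_one, projection_one_sub hQ2]
  have h2 := expect_mono hρ e2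
  rw [e, e1, mul_one, expect_add, expect_smul, expect_smul] at h1
  linarith

/-- Error of the square-root measurement operator `Λ` on `ρ`, after smoothing by `K`. -/
theorem expect_error_le {ρ L S T K : Matrix d d ℂ} (hρ : ρ.PosSemidef) (hρ1 : expect ρ 1 = 1)
    (hS : S.IsHermitian) (hS2 : S * S = S) (hL : L.PosSemidef) (hL1 : L ≤ 1) {η : ℝ}
    (hη : 0 ≤ η) (hK : Kᴴ * K ≤ 1)
    (hLS : 1 - L ≤ (2 : ℝ) • (1 - S) + (4 : ℝ) • (T + η • 1)) :
    expect ρ (1 - L) ≤ 8 * expect ρ (1 - S) + 10 * expect ρ ((1 - K)ᴴ * (1 - K))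
      + 8 * expect (K * ρ * Kᴴ) T + 8 * η := by
  have hL0 : (1 - L).PosSemidef := hL1
  have hL2 : 1 - L ≤ 1 := by
    rw [Matrix.le_iff]; simpa using hL
  have hS1 : 1 - S ≤ 1 := by
    rw [Matrix.le_iff]; simpa using posSemidef_of_projection hS hS2
  have h1 := expect_le_of_smoothing hρ hL0 hL2 K
  have hω : (K * ρ * Kᴴ).PosSemidef := hρ.mul_mul_conjTranspose_same K
  have h2 := expect_mono hω hLS
  have h3 := expect_conj_le_of_smoothing hρ (posSemidef_one_sub_projection hS hS2) hS1 K
  have h4 : expect (K * ρ * Kᴴ) 1 ≤ 1 := by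
    rw [expect_conj, mul_one, ← hρ1]
    exact expect_mono hρ hK
  rw [expect_add, expect_smul, expect_smul, expect_add, expect_smul] at h2
  -- Passing to the smoothed state costs 2 defects, and returning for `1 - S` costs 2 more with the
  -- prefactor 2 · 2, hence 10 in all.
  nlinarith

end CQBroadcast
end Expectation

/-! ### Product distributions and the weak law of large numbers. -/

section IID

namespace CQBroadcast

variable {ι α β : Type*} [Fintype ι] [DecidableEq ι] [Fintype α] [Fintype β]

theorem sum_pi_prod {R : Type*} [CommSemiring R] (f : ι → α → R) :
    ∑ r : ι → α, ∏ i, f i (r i) = ∏ i, ∑ a, f i a := by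
  classical
  rw [Finset.prod_univ_sum, Fintype.piFinset_univ]

theorem prod_mem_stdSimplex {μ : ι → α → ℝ} (hμ : ∀ i, μ i ∈ stdSimplex ℝ α) :
    (fun r : ι → α => ∏ i, μ i (r i)) ∈ stdSimplex ℝ (ι → α) :=
  ⟨fun r => Finset.prod_nonneg fun i _ => (hμ i).1 _, by
    rw [sum_pi_prod]; exact Finset.prod_eq_one fun i _ => (hμ i).2⟩

/-- Expectation of a function of one coordinate under a product distribution. -/
theorem sum_prod_mul_apply {μ : α → ℝ} (hμ : ∑ a, μ a = 1) (f : α → ℝ) (i : ι) :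
    ∑ r : ι → α, (∏ k, μ (r k)) * f (r i) = ∑ a, μ a * f a := by
  have h : ∀ r : ι → α, (∏ k, μ (r k)) * f (r i)
      = ∏ k, (μ (r k) * if k = i then f (r k) else 1) := fun r => by
    rw [Finset.prod_mul_distrib, Finset.prod_ite_eq']; simp
  simp_rw [h]
  rw [sum_pi_prod (fun k a => μ a * if k = i then f a else 1), Finset.prod_eq_single i]
  · simp
  · intro k _ hk; simp [hk, hμ]
  · simp

theorem sum_prod_mul_apply_mul_apply {μ : α → ℝ} (hμ : ∑ a, μ a = 1) (f g : α → ℝ) {i j : ι}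
    (hij : i ≠ j) : ∑ r : ι → α, (∏ k, μ (r k)) * (f (r i) * g (r j))
      = (∑ a, μ a * f a) * ∑ a, μ a * g a := by
  have h : ∀ r : ι → α, (∏ k, μ (r k)) * (f (r i) * g (r j))
      = ∏ k, (μ (r k) * ((if k = i then f (r k) else 1) * if k = j then g (r k) else 1)) :=
    fun r => by
      rw [Finset.prod_mul_distrib, Finset.prod_mul_distrib, Finset.prod_ite_eq',
        Finset.prod_ite_eq']; simp
  simp_rw [h]
  rw [sum_pi_prod (fun k a => μ a * ((if k = i then f a else 1) * if k = j then g a else 1)),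
    Finset.prod_eq_mul i j hij]
  · simp [hij, hij.symm]
  · intro k _ hk; simp [hk.1, hk.2, hμ]
  · simp
  · simp

/-- Expectation of a function of two coordinates under a product distribution. -/
theorem sum_prod_mul_apply₂ {μ : α → ℝ} (hμ : ∑ a, μ a = 1) (f : α → α → ℝ) {i j : ι}
    (hij : i ≠ j) : ∑ r : ι → α, (∏ k, μ (r k)) * f (r i) (r j)
      = ∑ a, μ a * ∑ b, μ b * f a b := by
  classical
  -- Expanding `f` over the values of its second argument reduces to products of one-coordinate
  -- functions.
  have h : ∀ r : ι → α, (∏ k, μ (r k)) * f (r i) (r j)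
      = ∑ b, (∏ k, μ (r k)) * (f (r i) b * if r j = b then 1 else 0) := fun r => by simp
  simp_rw [h]
  rw [Finset.sum_comm]
  simp_rw [fun b => sum_prod_mul_apply_mul_apply hμ (fun a => f a b)
    (fun a => if a = b then 1 else 0) hij, mul_ite, mul_one, mul_zero, Finset.sum_ite_eq',
    Finset.mem_univ, if_true, Finset.sum_mul, Finset.mul_sum]
  rw [Finset.sum_comm]
  exact Finset.sum_congr rfl fun a _ => Finset.sum_congr rfl fun b _ => by ring

/-- The distribution of a pair `(w, (xᵢ)ᵢ)` where the `xᵢ` are conditionally independent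
given `w`. -/
def rowWeight (p : α → ℝ) (q : α → β → ℝ) (r : α × (ι → β)) : ℝ := p r.1 * ∏ i, q r.1 (r.2 i)

theorem rowWeight_mem_stdSimplex {p : α → ℝ} {q : α → β → ℝ} (hp : p ∈ stdSimplex ℝ α)
    (hq : ∀ a, q a ∈ stdSimplex ℝ β) :
    (rowWeight p q : α × (ι → β) → ℝ) ∈ stdSimplex ℝ (α × (ι → β)) := by
  refine ⟨fun r => mul_nonneg (hp.1 _) (Finset.prod_nonneg fun i _ => (hq _).1 _), ?_⟩
  simp_rw [Fintype.sum_prod_type, rowWeight, ← Finset.mul_sum,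
    (prod_mem_stdSimplex fun _ : ι => hq _).2, mul_one, hp.2]

theorem sum_rowWeight_mul_apply (p : α → ℝ) {q : α → β → ℝ} (hq : ∀ a, q a ∈ stdSimplex ℝ β)
    (f : α → β → ℝ) (i : ι) :
    ∑ r : α × (ι → β), rowWeight p q r * f r.1 (r.2 i) = ∑ a, p a * ∑ b, q a b * f a b := by
  simp_rw [Fintype.sum_prod_type, rowWeight, mul_assoc, ← Finset.mul_sum,
    fun a => sum_prod_mul_apply (hq a).2 (f a) i]

theorem sum_rowWeight_mul_apply₂ (p : α → ℝ) {q : α → β → ℝ} (hq : ∀ a, q a ∈ stdSimplex ℝ β)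
    (f : α → β → β → ℝ) {i j : ι} (hij : i ≠ j) :
    ∑ r : α × (ι → β), rowWeight p q r * f r.1 (r.2 i) (r.2 j)
      = ∑ a, p a * ∑ b, q a b * ∑ c, q a c * f a b c := by
  simp_rw [Fintype.sum_prod_type, rowWeight, mul_assoc, ← Finset.mul_sum,
    fun a => sum_prod_mul_apply₂ (hq a).2 (f a) hij]

/-- Independent centred variables are uncorrelated, so only the diagonal of the squared sum
survives. -/
theorem sum_prod_mul_sq_sum {μ : α → ℝ} (hμ : ∑ a, μ a = 1) {Y : α → ℝ}
    (hY : ∑ a, μ a * Y a = 0) :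
    ∑ r : ι → α, (∏ k, μ (r k)) * (∑ k, Y (r k)) ^ 2
      = Fintype.card ι * ∑ a, μ a * Y a ^ 2 := by
  have h : ∀ i j : ι, ∑ r : ι → α, (∏ k, μ (r k)) * (Y (r i) * Y (r j))
      = if i = j then ∑ a, μ a * Y a ^ 2 else 0 := fun i j => by
    split_ifs with hij
    · subst hij
      simp_rw [← pow_two]
      exact sum_prod_mul_apply hμ (fun a => Y a ^ 2) i
    · rw [sum_prod_mul_apply_mul_apply hμ Y Y hij, hY, zero_mul]
  simp_rw [pow_two (∑ k, _), Finset.sum_mul_sum, Finset.mul_sum]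
  rw [Finset.sum_comm]
  simp_rw [Finset.sum_comm (s := (Finset.univ : Finset (ι → α))), h]
  simp [← Finset.mul_sum]

open Classical in
/-- Weak law of large numbers for a distribution on a finite set. -/
theorem weak_law {μ : α → ℝ} (hμ : μ ∈ stdSimplex ℝ α) (Z : α → ℝ) {ε δ : ℝ} (hε : 0 < ε)
    (hδ : 0 < δ) : ∀ᶠ n : ℕ in Filter.atTop,
      ∑ r : Fin n → α with n * δ < |∑ k, Z (r k) - n * ∑ a, μ a * Z a|, ∏ k, μ (r k) ≤ ε := by
  set H := ∑ a, μ a * Z a with hH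
  set V := ∑ a, μ a * (Z a - H) ^ 2
  have hY : ∑ a, μ a * (Z a - H) = 0 := by
    simp_rw [mul_sub, Finset.sum_sub_distrib, ← Finset.sum_mul, hμ.2, one_mul, ← hH, sub_self]
  have hlim : ∀ᶠ n : ℕ in Filter.atTop, V / (ε * δ ^ 2) ≤ n :=
    tendsto_natCast_atTop_atTop.eventually_ge_atTop _
  filter_upwards [hlim, Filter.eventually_gt_atTop 0] with n hn hn0
  have hn0' : (0 : ℝ) < n := by exact_mod_cast hn0
  have hw : ∀ r : Fin n → α, 0 ≤ ∏ k, μ (r k) := fun r => Finset.prod_nonneg fun k _ => hμ.1 _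
  have key := sum_prod_mul_sq_sum (ι := Fin n) hμ.2 hY
  -- Chebyshev's inequality: on the deviation event the squared sum exceeds `(n δ)²`.
  have h1 : (∑ r : Fin n → α with n * δ < |∑ k, Z (r k) - n * H|, ∏ k, μ (r k)) * (n * δ) ^ 2
      ≤ n * V := by
    rw [Finset.sum_mul]
    have : ∀ r : Fin n → α, ∑ k, (Z (r k) - H) = ∑ k, Z (r k) - n * H := fun r => by simp
    simp_rw [this, Fintype.card_fin] at key
    rw [← key]
    refine (Finset.sum_le_sum fun r hr => ?_).trans
      (Finset.sum_le_sum_of_subset_of_nonneg (Finset.filter_subset _ _)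
        fun r _ _ => mul_nonneg (hw r) (sq_nonneg _))
    refine mul_le_mul_of_nonneg_left ?_ (hw r)
    rw [← sq_abs (∑ k, Z (r k) - n * H)]
    exact pow_le_pow_left₀ (by positivity) (Finset.mem_filter.1 hr).2.le 2
  rw [div_le_iff₀ (by positivity)] at hn
  have h2 : n * V ≤ ε * (n * δ) ^ 2 := by nlinarith
  exact le_of_mul_le_mul_right (h1.trans h2) (by positivity)

end CQBroadcast
end IID

/-! ### Explicit diagonalisations, entropy, and tensor powers. -/

section Tensor
open scoped MatrixOrder
open Matrix

namespace CQBroadcast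

section ConjDiag

variable {e : Type*} [Fintype e] [DecidableEq e]

/-- The operator `U diag(f) U†`. -/
noncomputable def conjDiag (U : Matrix e e ℂ) (f : e → ℝ) : Matrix e e ℂ :=
  U * diagonal (fun i => (f i : ℂ)) * Uᴴ

variable {U : Matrix e e ℂ}

theorem conjDiag_mul (hU : Uᴴ * U = 1) (f g : e → ℝ) :
    conjDiag U f * conjDiag U g = conjDiag U (f * g) := by
  have : conjDiag U f * conjDiag U g = U * diagonal (fun i => (f i : ℂ)) * (Uᴴ * U)
      * diagonal (fun i => (g i : ℂ)) * Uᴴ := by simp only [conjDiag, mul_assoc]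
  rw [this, hU, mul_one, mul_assoc U, diagonal_mul_diagonal]
  simp [conjDiag]

theorem isHermitian_conjDiag (f : e → ℝ) : (conjDiag U f).IsHermitian := by
  refine isHermitian_mul_mul_conjTranspose _ (isHermitian_diagonal_of_self_adjoint _ ?_)
  ext i; simp

theorem conjDiag_sub (f g : e → ℝ) : conjDiag U f - conjDiag U g = conjDiag U (f - g) := by
  have h : (fun i => ((f - g) i : ℂ)) = (fun i => (f i : ℂ)) - fun i => (g i : ℂ) := by
    ext i; simp
  rw [conjDiag, conjDiag, conjDiag, h, ← sub_mul, ← mul_sub, diagonal_sub]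
  rfl

theorem posSemidef_conjDiag {f : e → ℝ} (hf : 0 ≤ f) : (conjDiag U f).PosSemidef :=
  (PosSemidef.diagonal fun i => by simpa using hf i).mul_mul_conjTranspose_same U

theorem conjDiag_mono {f g : e → ℝ} (h : f ≤ g) : conjDiag U f ≤ conjDiag U g :=
  le_of_sub_eq_posSemidef (posSemidef_conjDiag (sub_nonneg.2 h)) (conjDiag_sub g f)

theorem conjDiag_const (hU : U * Uᴴ = 1) (c : ℝ) :
    conjDiag U (fun _ => c) = c • (1 : Matrix e e ℂ) := by
  have : (diagonal fun _ : e => (c : ℂ)) = c • (1 : Matrix e e ℂ) := by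
    ext i j; by_cases h : i = j <;> simp [h]
  rw [conjDiag, this, mul_smul_comm, mul_one, smul_mul_assoc, hU]

theorem trace_conjDiag (hU : Uᴴ * U = 1) (f : e → ℝ) :
    (conjDiag U f).trace = ((∑ i, f i : ℝ) : ℂ) := by
  rw [conjDiag, trace_mul_comm, ← mul_assoc, hU, one_mul, trace_diagonal]
  simp

theorem charpoly_conjDiag (hU : Uᴴ * U = 1) (f : e → ℝ) :
    (conjDiag U f).charpoly = ∏ i, (Polynomial.X - Polynomial.C (f i : ℂ)) := by
  rw [conjDiag, charpoly_mul_comm, ← mul_assoc, hU, one_mul, charpoly_diagonal]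

theorem eq_conjDiag {A : Matrix e e ℂ} (hA : A.IsHermitian) :
    A = conjDiag (hA.eigenvectorUnitary : Matrix e e ℂ) hA.eigenvalues := by
  conv_lhs => rw [hA.spectral_theorem, Unitary.conjStarAlgAut_apply]
  rfl

/-- The characteristic polynomial determines the eigenvalues with multiplicity. Entropy can
therefore be read off from any unitary diagonalisation. -/
theorem sum_eigenvalues_conjDiag (hU : Uᴴ * U = 1) (f : e → ℝ) (g : ℝ → ℝ) :
    ∑ i, g ((isHermitian_conjDiag (U := U) f).eigenvalues i) = ∑ i, g (f i) := by
  have h1 := (isHermitian_conjDiag (U := U) f).roots_charpoly_eq_eigenvalues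
  have h2 : (conjDiag U f).charpoly.roots = Finset.univ.val.map fun i => (f i : ℂ) := by
    rw [charpoly_conjDiag hU, Polynomial.roots_prod]
    · simp
    · exact Finset.prod_ne_zero_iff.2 fun i _ => Polynomial.X_sub_C_ne_zero _
  have h3 := congrArg (fun s : Multiset ℂ => (s.map fun z => g z.re).sum) (h1.symm.trans h2)
  simpa [Multiset.map_map, Function.comp_def] using h3

theorem entropy_eq_sum_eigenvalues {A : Matrix e e ℂ} (hA : A.IsHermitian) :
    entropy A = -∑ i, hA.eigenvalues i * Real.logb 2 (hA.eigenvalues i) := by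
  have hU : (hA.eigenvectorUnitary : Matrix e e ℂ)ᴴ * (hA.eigenvectorUnitary : Matrix e e ℂ) = 1 :=
    Unitary.coe_star_mul_self _
  have h : cfc (Real.logb 2) A = conjDiag (hA.eigenvectorUnitary : Matrix e e ℂ)
      (fun i => Real.logb 2 (hA.eigenvalues i)) := by
    rw [hA.cfc_eq, IsHermitian.cfc, Unitary.conjStarAlgAut_apply]
    rfl
  have h2 : A * cfc (Real.logb 2) A = conjDiag (hA.eigenvectorUnitary : Matrix e e ℂ)
      (hA.eigenvalues * fun i => Real.logb 2 (hA.eigenvalues i)) := by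
    rw [h, ← conjDiag_mul hU, ← eq_conjDiag hA]
  rw [entropy, h2, trace_conjDiag hU, Complex.ofReal_re]
  rfl

theorem entropy_conjDiag (hU : Uᴴ * U = 1) (f : e → ℝ) :
    entropy (conjDiag U f) = -∑ i, f i * Real.logb 2 (f i) := by
  rw [entropy_eq_sum_eigenvalues (isHermitian_conjDiag f),
    sum_eigenvalues_conjDiag hU f fun x => x * Real.logb 2 x]

end ConjDiag

section Tens

variable {ι b : Type*} [Fintype ι]

/-- The tensor product of a family of operators on `ℂ^b`. -/
def tens (A : ι → Matrix b b ℂ) : Matrix (ι → b) (ι → b) ℂ :=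
  Matrix.of fun i j => ∏ k, A k (i k) (j k)

theorem conjTranspose_tens (A : ι → Matrix b b ℂ) : (tens A)ᴴ = tens fun k => (A k)ᴴ := by
  ext i j; simp [tens]

variable [DecidableEq ι]

/-- Distributivity. Hence averaging product states over a product law yields the product of the
averages, so cloud states are again products. -/
theorem sum_smul_tens {α : Type*} [Fintype α] (p : ι → α → ℝ) (σ : ι → α → Matrix b b ℂ) :
    ∑ x : ι → α, (∏ k, p k (x k)) • tens (fun k => σ k (x k))
      = tens fun k => ∑ a, p k a • σ k a := by
  ext i j
  simp only [tens, Matrix.sum_apply, Matrix.smul_apply, of_apply]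
  rw [← sum_pi_prod fun k a => p k a • σ k a (i k) (j k)]
  simp [Finset.prod_mul_distrib]

variable [Fintype b]

theorem tens_mul (A B : ι → Matrix b b ℂ) : tens A * tens B = tens fun k => A k * B k := by
  ext i j
  simp only [tens, mul_apply, of_apply, ← Finset.prod_mul_distrib]
  exact sum_pi_prod fun k a => A k (i k) a * B k a (j k)

theorem trace_tens (A : ι → Matrix b b ℂ) : (tens A).trace = ∏ k, (A k).trace := by
  simp only [tens, trace, diag_apply, of_apply]
  exact sum_pi_prod fun k a => A k a a

variable [DecidableEq b]

omit [DecidableEq ι] [Fintype b] in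
theorem tens_diagonal (v : ι → b → ℂ) :
    tens (fun k => diagonal (v k)) = diagonal fun i : ι → b => ∏ k, v k (i k) := by
  ext i j
  by_cases h : i = j
  · subst h; simp [tens]
  · obtain ⟨k, hk⟩ := Function.ne_iff.1 h
    simp only [tens, of_apply, diagonal_apply_ne _ h]
    exact Finset.prod_eq_zero (Finset.mem_univ k) (diagonal_apply_ne _ hk)

omit [DecidableEq ι] [Fintype b] in
theorem tens_one : tens (fun _ : ι => (1 : Matrix b b ℂ)) = 1 := by
  simp_rw [← diagonal_one, tens_diagonal, Finset.prod_const_one]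

theorem tens_conjDiag (U : ι → Matrix b b ℂ) (v : ι → b → ℝ) :
    tens (fun k => conjDiag (U k) (v k)) = conjDiag (tens U) fun i => ∏ k, v k (i k) := by
  simp_rw [conjDiag, ← tens_mul, tens_diagonal, conjTranspose_tens, Complex.ofReal_prod]

omit [DecidableEq b] in
theorem isDensity_tens {A : ι → Matrix b b ℂ} (hA : ∀ k, IsDensity (A k)) :
    IsDensity (tens A) := by
  classical
  refine ⟨?_, by rw [trace_tens]; exact Finset.prod_eq_one fun k _ => (hA k).2⟩
  choose B hB using fun k => CStarAlgebra.nonneg_iff_eq_star_mul_self.mp (hA k).1.nonneg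
  have : tens A = (tens B)ᴴ * tens B := by
    rw [conjTranspose_tens, tens_mul]
    exact congrArg tens (funext hB)
  rw [this]
  exact posSemidef_conjTranspose_mul_self _

end Tens
end CQBroadcast
end Tensor

/-! ### Typical projections. -/

section Typical
open scoped MatrixOrder
open Matrix

namespace CQBroadcast

/-- `Q` is a spectral projection of `σ` of rank at most `D` on which `σ ≤ c`. -/
structure IsTypicalProjection {e : Type*} [Fintype e] [DecidableEq e] (σ Q : Matrix e e ℂ)
    (c D : ℝ) : Prop where
  isHermitian : Q.IsHermitian
  mul_self : Q * Q = Q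
  conj_le : Q * σ * Q ≤ σ
  conj_le_smul : Q * σ * Q ≤ c • 1
  trace_le : expect 1 Q ≤ D

/-- Keep the eigenvectors with eigenvalue in `[s, t]`. The upper end bounds the compressed state;
since the eigenvalues sum to one, at most `s⁻¹` of them reach the lower end. -/
theorem exists_isTypicalProjection {e : Type*} [Fintype e] [DecidableEq e] {U : Matrix e e ℂ}
    (hU : Uᴴ * U = 1) {v : e → ℝ} (hv : v ∈ stdSimplex ℝ e) {s t : ℝ} (hs : 0 < s)
    (ht : 0 ≤ t) : ∃ Q, IsTypicalProjection (conjDiag U v) Q t s⁻¹ ∧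
      expect (conjDiag U v) (1 - Q) = ∑ i, if s ≤ v i ∧ v i ≤ t then 0 else v i := by
  classical
  have hU' : U * Uᴴ = 1 := mul_eq_one_comm.1 hU
  set g : e → ℝ := fun i => if s ≤ v i ∧ v i ≤ t then 1 else 0 with hg
  have hone : (1 : Matrix e e ℂ) = conjDiag U fun _ => 1 := by
    rw [conjDiag_const hU', one_smul]
  have hgg : g * g = g := by
    ext i; simp only [hg, Pi.mul_apply]; split_ifs <;> simp
  have hgvg : conjDiag U g * conjDiag U v * conjDiag U g = conjDiag U (v * g) := by
    rw [conjDiag_mul hU, conjDiag_mul hU, mul_comm g v, mul_assoc, hgg]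
  refine ⟨conjDiag U g, ⟨isHermitian_conjDiag g, by rw [conjDiag_mul hU, hgg], ?_, ?_, ?_⟩, ?_⟩
  · rw [hgvg]
    refine conjDiag_mono fun i => ?_
    simp only [hg, Pi.mul_apply]
    split_ifs
    exacts [(mul_one _).le, by simpa using hv.1 i]
  · rw [hgvg, ← conjDiag_const hU']
    refine conjDiag_mono fun i => ?_
    simp only [hg, Pi.mul_apply]
    split_ifs with h
    exacts [by simpa using h.2, by simpa using ht]
  · rw [expect, mul_one, trace_conjDiag hU, Complex.ofReal_re, ← one_div, le_div_iff₀ hs,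
      Finset.sum_mul, ← hv.2]
    refine Finset.sum_le_sum fun i _ => ?_
    simp only [hg]
    split_ifs with h
    exacts [by simpa using h.1, by simpa using hv.1 i]
  · rw [expect, hone, conjDiag_sub, conjDiag_mul hU, trace_conjDiag hU, Complex.ofReal_re]
    refine Finset.sum_congr rfl fun i _ => ?_
    simp only [hg, Pi.mul_apply, Pi.sub_apply]
    split_ifs <;> simp

theorem eigenvalues_mem_stdSimplex {b : Type*} [Fintype b] [DecidableEq b] {σ : Matrix b b ℂ}
    (hσ : IsDensity σ) : hσ.1.1.eigenvalues ∈ stdSimplex ℝ b := by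
  refine ⟨hσ.1.eigenvalues_nonneg, ?_⟩
  simpa using congrArg Complex.re (hσ.1.1.trace_eq_sum_eigenvalues.symm.trans hσ.2)

/-- Existence of conditionally weakly typical projections. -/
theorem eventually_exists_typical_projections {α b : Type*} [Fintype α] [Fintype b]
    [DecidableEq b] {p : α → ℝ} (hp : p ∈ stdSimplex ℝ α) {σ : α → Matrix b b ℂ}
    (hσ : ∀ a, IsDensity (σ a)) {ε δ : ℝ} (hε : 0 < ε) (hδ : 0 < δ) :
    ∀ᶠ n : ℕ in Filter.atTop,
      ∃ Q : (Fin n → α) → Matrix (Fin n → b) (Fin n → b) ℂ,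
        (∀ a, IsTypicalProjection (tens fun k => σ (a k)) (Q a)
          ((2 : ℝ) ^ (-(n * (∑ a, p a * entropy (σ a) - δ))))
          ((2 : ℝ) ^ (n * (∑ a, p a * entropy (σ a) + δ)))) ∧
        ∑ a : Fin n → α, (∏ k, p (a k)) * expect (tens fun k => σ (a k)) (1 - Q a) ≤ ε := by
  classical
  set v : α → b → ℝ := fun a => (hσ a).1.1.eigenvalues with hv
  have hvs : ∀ a, v a ∈ stdSimplex ℝ b := fun a => eigenvalues_mem_stdSimplex (hσ a)
  set U : α → Matrix b b ℂ := fun a => ((hσ a).1.1.eigenvectorUnitary : Matrix b b ℂ)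
  have hU : ∀ a, (U a)ᴴ * U a = 1 := fun a => Unitary.coe_star_mul_self _
  have hσU : ∀ a, σ a = conjDiag (U a) (v a) := fun a => eq_conjDiag (hσ a).1.1
  set H := ∑ a, p a * entropy (σ a) with hH
  -- Joint law of a letter and an eigenvalue index. The mean of `-log₂` of the eigenvalue is the
  -- average entropy `H`, so typicality becomes a classical law of large numbers.
  set μ : α × b → ℝ := fun r => p r.1 * v r.1 r.2 with hμ_def
  have hμ : μ ∈ stdSimplex ℝ (α × b) := by
    refine ⟨fun r => mul_nonneg (hp.1 _) ((hvs _).1 _), ?_⟩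
    simp_rw [hμ_def, Fintype.sum_prod_type, ← Finset.mul_sum, (hvs _).2, mul_one, hp.2]
  have hmean : ∑ r, μ r * -Real.logb 2 (v r.1 r.2) = H := by
    simp_rw [hH, hμ_def, Fintype.sum_prod_type, mul_assoc, ← Finset.mul_sum]
    refine Finset.sum_congr rfl fun a _ => ?_
    rw [entropy_eq_sum_eigenvalues (hσ a).1.1]
    simp [hv]
  filter_upwards [weak_law hμ (fun r => -Real.logb 2 (v r.1 r.2)) hε hδ] with n hn
  rw [hmean] at hn
  have hσn : ∀ a : Fin n → α, (tens fun k => σ (a k))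
      = conjDiag (tens fun k => U (a k)) fun i => ∏ k, v (a k) (i k) := fun a => by
    rw [← tens_conjDiag]
    exact congrArg tens (funext fun k => hσU (a k))
  have hUn : ∀ a : Fin n → α, (tens fun k => U (a k))ᴴ * (tens fun k => U (a k)) = 1 :=
    fun a => by
      rw [conjTranspose_tens, tens_mul, ← tens_one]
      exact congrArg tens (funext fun k => hU (a k))
  have hvn : ∀ a : Fin n → α, (fun i : Fin n → b => ∏ k, v (a k) (i k)) ∈ stdSimplex ℝ _ :=
    fun a => prod_mem_stdSimplex fun k => hvs (a k)
  -- The eigenvalue window is centred at the average entropy for every sequence `a`. Thus the size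
  -- bounds hold for all `a`, and atypical sequences enter only through the averaged error.
  choose Q hQ hQe using fun a : Fin n → α => exists_isTypicalProjection (hUn a) (hvn a)
    (s := (2 : ℝ) ^ (-(n * (H + δ)))) (t := (2 : ℝ) ^ (-(n * (H - δ)))) (by positivity)
    (by positivity)
  refine ⟨Q, fun a => ?_, ?_⟩
  · rw [hσn]
    have := hQ a
    rwa [← Real.rpow_neg (by norm_num), neg_neg] at this
  refine le_trans ?_ hn
  simp_rw [hσn, hQe, Finset.mul_sum]
  rw [Finset.sum_filter, ← (Equiv.arrowProdEquivProdArrow (Fin n) (fun _ => α) fun _ => b).symm.sum_comp,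
    Fintype.sum_prod_type]
  refine Finset.sum_le_sum fun a _ => Finset.sum_le_sum fun y _ => ?_
  simp only [Equiv.arrowProdEquivProdArrow_symm_apply]
  have hprod : ∏ k, μ (a k, y k) = (∏ k, p (a k)) * ∏ k, v (a k) (y k) :=
    Finset.prod_mul_distrib
  have hnn : 0 ≤ ∏ k, μ (a k, y k) := Finset.prod_nonneg fun k _ => hμ.1 _
  by_cases hG : (2 : ℝ) ^ (-(n * (H + δ))) ≤ ∏ k, v (a k) (y k) ∧
      ∏ k, v (a k) (y k) ≤ (2 : ℝ) ^ (-(n * (H - δ)))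
  · rw [if_pos hG, mul_zero]
    split_ifs
    exacts [hnn, le_rfl]
  rw [if_neg hG, ← hprod]
  -- Null sequences contribute nothing. They are set aside because the logarithm of the product
  -- splits only when no factor vanishes.
  by_cases h0 : ∏ k, μ (a k, y k) = 0
  · simp [h0]
  rw [if_pos]
  by_contra hle
  refine hG ?_
  have hpos : 0 < ∏ k, v (a k) (y k) := by
    refine lt_of_le_of_ne ((hvn a).1 y) fun h => h0 ?_
    rw [hprod, ← h, mul_zero]
  have hlog : ∑ k, -Real.logb 2 (v (a k) (y k)) = -Real.logb 2 (∏ k, v (a k) (y k)) := by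
    rw [Real.logb_prod _ _ fun k hk h => hpos.ne' (Finset.prod_eq_zero hk h),
      Finset.sum_neg_distrib]
  rw [hlog, not_lt, abs_le] at hle
  have h2 : (2 : ℝ) ^ Real.logb 2 (∏ k, v (a k) (y k)) = ∏ k, v (a k) (y k) :=
    Real.rpow_logb (by norm_num) (by norm_num) hpos
  rw [← h2]
  constructor <;> refine Real.rpow_le_rpow_of_exponent_le (by norm_num) ?_ <;> linarith [hle.1, hle.2]

end CQBroadcast
end Typical

/-! ### Information quantities of the code state as entropy differences. -/

section Information
open scoped MatrixOrder
open Matrix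

namespace CQBroadcast

section Entropy

theorem entropy_diagonal {e : Type*} [Fintype e] [DecidableEq e] (f : e → ℝ) :
    entropy (diagonal fun i => (f i : ℂ)) = -∑ i, f i * Real.logb 2 (f i) := by
  rw [← entropy_conjDiag (U := 1) (by simp) f, conjDiag]
  simp

theorem submatrix_conjDiag {s e : Type*} [Fintype s] [DecidableEq s] [Fintype e] [DecidableEq e]
    (φ : s ≃ e) (U : Matrix e e ℂ) (f : e → ℝ) :
    (conjDiag U f).submatrix φ φ = conjDiag (U.submatrix φ φ) (f ∘ φ) := by
  rw [conjDiag, conjDiag, conjTranspose_submatrix, ← submatrix_mul_equiv _ _ _ φ,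
    ← submatrix_mul_equiv _ _ _ φ]
  congr 2
  exact submatrix_diagonal_equiv _ φ

/-- Entropy of a classical-quantum state. -/
theorem entropy_blockDiagonal {s d a : Type*} [Fintype s] [DecidableEq s] [Fintype d]
    [DecidableEq d] [Fintype a] [DecidableEq a] (φ : s ≃ d × a) (p : a → ℝ)
    {σ : a → Matrix d d ℂ} (hσ : ∀ i, IsDensity (σ i)) :
    entropy ((blockDiagonal fun i => p i • σ i).submatrix φ φ)
      = -∑ i, p i * Real.logb 2 (p i) + ∑ i, p i * entropy (σ i) := by
  set v : a → d → ℝ := fun i => (hσ i).1.1.eigenvalues with hv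
  have hvs : ∀ i, v i ∈ stdSimplex ℝ d := fun i => eigenvalues_mem_stdSimplex (hσ i)
  set U : a → Matrix d d ℂ := fun i => ((hσ i).1.1.eigenvectorUnitary : Matrix d d ℂ)
  have hU : ∀ i, (U i)ᴴ * U i = 1 := fun i => Unitary.coe_star_mul_self _
  have hσU : ∀ i, σ i = conjDiag (U i) (v i) := fun i => eq_conjDiag (hσ i).1.1
  have h1 : (blockDiagonal fun i => p i • σ i)
      = conjDiag (blockDiagonal U) fun k => p k.2 * v k.2 k.1 := by
    rw [conjDiag, ← blockDiagonal_diagonal (fun j k => ((p j * v j k : ℝ) : ℂ)),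
      blockDiagonal_conjTranspose, ← blockDiagonal_mul, ← blockDiagonal_mul]
    congr 1
    funext i
    have h2 : (diagonal fun k => ((p i * v i k : ℝ) : ℂ))
        = p i • diagonal fun k => (v i k : ℂ) := by
      ext j k; by_cases h : j = k <;> simp [h]
    rw [h2, mul_smul_comm, smul_mul_assoc]
    exact congrArg _ (hσU i)
  have hUU : ((blockDiagonal U).submatrix φ φ)ᴴ * (blockDiagonal U).submatrix φ φ = 1 := by
    rw [conjTranspose_submatrix, submatrix_mul_equiv, blockDiagonal_conjTranspose,
      ← blockDiagonal_mul]
    simp_rw [hU]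
    rw [show (blockDiagonal fun _ : a => (1 : Matrix d d ℂ)) = 1 from blockDiagonal_one,
      submatrix_one_equiv]
  -- This also holds at zero, thanks to the factors in front of the logarithms.
  have hterm : ∀ x y : ℝ, x * y * Real.logb 2 (x * y)
      = y * (x * Real.logb 2 x) + x * (y * Real.logb 2 y) := fun x y => by
    by_cases hx : x = 0
    · simp [hx]
    by_cases hy : y = 0
    · simp [hy]
    rw [Real.logb_mul hx hy]; ring
  rw [h1, submatrix_conjDiag, entropy_conjDiag hUU]
  simp only [Function.comp_apply]
  rw [φ.sum_comp
    fun k => p k.2 * v k.2 k.1 * Real.logb 2 (p k.2 * v k.2 k.1), Fintype.sum_prod_type_right,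
    neg_add_eq_sub, neg_eq_iff_eq_neg, neg_sub, ← Finset.sum_sub_distrib]
  refine Finset.sum_congr rfl fun i _ => ?_
  simp_rw [hterm, Finset.sum_add_distrib, ← Finset.sum_mul, (hvs i).2, one_mul, ← Finset.mul_sum]
  rw [entropy_eq_sum_eigenvalues (hσ i).1.1]
  simp [hv]

end Entropy

theorem isDensity_sum_smul {ι d : Type*} [Fintype ι] [Fintype d] {p : ι → ℝ}
    (hp : p ∈ stdSimplex ℝ ι) {σ : ι → Matrix d d ℂ} (hσ : ∀ i, IsDensity (σ i)) :
    IsDensity (∑ i, p i • σ i) := by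
  refine ⟨posSemidef_sum _ fun i _ => (hσ i).1.smul (hp.1 i), ?_⟩
  simp only [trace_sum, trace_smul, (hσ _).2, Complex.real_smul, mul_one]
  exact_mod_cast hp.2

theorem isDensity_partialTrace_snd {d e : Type*} [Fintype d] [Fintype e]
    {ρ : Matrix (d × e) (d × e) ℂ} (hρ : IsDensity ρ) :
    IsDensity (partialTrace (fun (i : d) (k : e) => (i, k)) ρ) := by
  constructor
  · have : partialTrace (fun (i : d) (k : e) => (i, k)) ρ
        = ∑ k, ρ.submatrix (fun i => (i, k)) fun i => (i, k) := by
      ext i j; simp [partialTrace, Matrix.sum_apply]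
    rw [this]
    exact posSemidef_sum _ fun k _ => hρ.1.submatrix _
  · rw [← hρ.2]
    simp [partialTrace, trace, Fintype.sum_prod_type]

theorem isDensity_partialTrace_fst {d e : Type*} [Fintype d] [Fintype e]
    {ρ : Matrix (d × e) (d × e) ℂ} (hρ : IsDensity ρ) :
    IsDensity (partialTrace (fun (i : e) (k : d) => (k, i)) ρ) := by
  constructor
  · have : partialTrace (fun (i : e) (k : d) => (k, i)) ρ
        = ∑ k, ρ.submatrix (fun i => (k, i)) fun i => (k, i) := by
      ext i j; simp [partialTrace, Matrix.sum_apply]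
    rw [this]
    exact posSemidef_sum _ fun k _ => hρ.1.submatrix _
  · rw [← hρ.2]
    simp [partialTrace, trace, Fintype.sum_prod_type_right]

variable {X W b₁ b₂ : Type*} [Fintype b₁] [Fintype b₂]

/-- The channel output at Receiver 1. -/
def Channel.state₁ (N : Channel X b₁ b₂) (x : X) : Matrix b₁ b₁ ℂ :=
  partialTrace (fun (i : b₁) (k : b₂) => (i, k)) (N.state x)

/-- The channel output at Receiver 2. -/
def Channel.state₂ (N : Channel X b₁ b₂) (x : X) : Matrix b₂ b₂ ℂ :=
  partialTrace (fun (i : b₂) (k : b₁) => (k, i)) (N.state x)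

theorem Channel.isDensity₁ (N : Channel X b₁ b₂) (x : X) : IsDensity (N.state₁ x) :=
  isDensity_partialTrace_snd (N.isDensity x)

theorem Channel.isDensity₂ (N : Channel X b₁ b₂) (x : X) : IsDensity (N.state₂ x) :=
  isDensity_partialTrace_fst (N.isDensity x)

variable [DecidableEq b₁] [DecidableEq b₂] [Fintype W] [DecidableEq W] [Fintype X] [DecidableEq X]
  (N : Channel X b₁ b₂) {pW : W → ℝ} {pXW : W → X → ℝ}

omit [DecidableEq b₁] [DecidableEq b₂] in
theorem codeState_apply (pW : W → ℝ) (pXW : W → X → ℝ) (s t : W × X × b₁ × b₂) :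
    codeState N pW pXW s t = if s.1 = t.1 ∧ s.2.1 = t.2.1 then
      ((pW s.1 * pXW s.1 s.2.1 : ℝ) : ℂ) * N.state s.2.1 s.2.2 t.2.2 else 0 := by
  obtain ⟨w, x, k⟩ := s
  obtain ⟨w', x', k'⟩ := t
  simp only [codeState, Matrix.sum_apply, Matrix.smul_apply, kroneckerMap_apply, smul_eq_mul,
    single_apply]
  rw [Finset.sum_eq_single w, Finset.sum_eq_single x]
  · by_cases h : w = w' <;> by_cases h' : x = x' <;> simp [h, h']
  · intro y _ hy; simp [hy]
  · simp
  · intro y _ hy; simp [hy]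
  · simp

omit [Fintype W] [DecidableEq W] [Fintype X] [DecidableEq X] [DecidableEq b₁]
  [DecidableEq b₂] in
theorem Channel.sum_state₁_diag (x : X) : ∑ i, N.state₁ x i i = 1 := (N.isDensity₁ x).2

omit [DecidableEq b₁] [DecidableEq b₂] in
theorem partialTrace_codeState_XB₁W :
    partialTrace (fun (i : X × b₁ × W) (k : b₂) => (i.2.2, i.1, i.2.1, k)) (codeState N pW pXW)
      = Matrix.of fun s t => if s.2.2 = t.2.2 ∧ s.1 = t.1 then
          ((pW s.2.2 * pXW s.2.2 s.1 : ℝ) : ℂ) * N.state₁ s.1 s.2.1 t.2.1 else 0 := by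
  ext ⟨x, i, w⟩ ⟨x', i', w'⟩
  simp only [partialTrace, of_apply, codeState_apply]
  split_ifs
  · rw [← Finset.mul_sum]; rfl
  · simp

omit [DecidableEq b₂] in
-- All four marginals are diagonal or block diagonal, and the Shannon entropies of `XW` and `W`
-- cancel. What remains is the difference of exponents that appears in the same-cloud error.
theorem infoXB₁W_codeState (hpXW : ∀ w, pXW w ∈ stdSimplex ℝ X) :
    infoXB₁W (codeState N pW pXW)
      = ∑ w, pW w * entropy (∑ x, pXW w x • N.state₁ x)
        - ∑ w, pW w * ∑ x, pXW w x * entropy (N.state₁ x) := by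
  rw [infoXB₁W, partialTrace_codeState_XB₁W, condMutualInfo]
  set τ : Matrix (X × b₁ × W) (X × b₁ × W) ℂ := Matrix.of fun s t =>
    if s.2.2 = t.2.2 ∧ s.1 = t.1 then
      ((pW s.2.2 * pXW s.2.2 s.1 : ℝ) : ℂ) * N.state₁ s.1 s.2.1 t.2.1 else 0 with hτ
  have e1 : partialTrace (fun (i : X × W) (k : b₁) => (i.1, k, i.2)) τ
      = diagonal fun i => ((pW i.2 * pXW i.2 i.1 : ℝ) : ℂ) := by
    ext ⟨x, w⟩ ⟨x', w'⟩
    simp only [partialTrace, of_apply, hτ, diagonal_apply, Prod.mk.injEq]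
    by_cases h : w = w' <;> by_cases h' : x = x' <;>
      simp only [h, h', and_self, and_true, and_false, if_true, if_false, Finset.sum_const_zero]
    rw [← Finset.mul_sum, N.sum_state₁_diag, mul_one]
  have e2 : partialTrace (fun (i : b₁ × W) (k : X) => (k, i.1, i.2)) τ
      = (blockDiagonal fun w => pW w • ∑ x, pXW w x • N.state₁ x).submatrix
          (Equiv.refl _) (Equiv.refl _) := by
    ext ⟨i, w⟩ ⟨i', w'⟩
    simp only [partialTrace, of_apply, hτ, submatrix_apply, Equiv.refl_apply,
      blockDiagonal_apply]
    by_cases h : w = w'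
    · simp [h, Matrix.sum_apply, Finset.mul_sum, mul_assoc]
    · simp [h]
  have e3 : τ = (blockDiagonal fun i : X × W => (pW i.2 * pXW i.2 i.1) • N.state₁ i.1).submatrix
      (⟨fun s => (s.2.1, s.1, s.2.2), fun s => (s.2.1, s.1, s.2.2), fun _ => rfl, fun _ => rfl⟩ :
        X × b₁ × W ≃ b₁ × X × W)
      (⟨fun s => (s.2.1, s.1, s.2.2), fun s => (s.2.1, s.1, s.2.2), fun _ => rfl, fun _ => rfl⟩ :
        X × b₁ × W ≃ b₁ × X × W) := by
    ext ⟨x, i, w⟩ ⟨x', i', w'⟩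
    simp only [of_apply, hτ, submatrix_apply, Equiv.coe_fn_mk, blockDiagonal_apply,
      Prod.mk.injEq, Matrix.smul_apply, Complex.real_smul, and_comm]
  have e4 : partialTrace (fun (i : W) (k : X × b₁) => (k.1, k.2, i)) τ
      = diagonal fun w => (pW w : ℂ) := by
    ext w w'
    simp only [partialTrace, of_apply, hτ, diagonal_apply, Fintype.sum_prod_type]
    by_cases h : w = w'
    · subst h
      simp only [true_and, if_true, ← Finset.mul_sum, N.sum_state₁_diag, mul_one]
      rw [← Complex.ofReal_sum, ← Finset.mul_sum, (hpXW w).2, mul_one]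
    · simp [h]
  rw [e1, e2, e4, entropy_diagonal, entropy_diagonal, entropy_blockDiagonal _ _ fun w =>
    isDensity_sum_smul (hpXW w) N.isDensity₁, e3, entropy_blockDiagonal _ _ fun i : X × W =>
    N.isDensity₁ i.1]
  have : ∑ i : X × W, pW i.2 * pXW i.2 i.1 * entropy (N.state₁ i.1)
      = ∑ w, pW w * ∑ x, pXW w x * entropy (N.state₁ x) := by
    simp_rw [Fintype.sum_prod_type_right, mul_assoc, ← Finset.mul_sum]
  rw [this]
  ring

omit [DecidableEq b₁] in
theorem infoWB₂_codeState (hpXW : ∀ w, pXW w ∈ stdSimplex ℝ X) :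
    infoWB₂ (codeState N pW pXW)
      = entropy (∑ w, pW w • ∑ x, pXW w x • N.state₂ x)
        - ∑ w, pW w * entropy (∑ x, pXW w x • N.state₂ x) := by
  rw [infoWB₂, mutualInfo]
  set τ := partialTrace (fun (i : W × b₂) (k : X × b₁) => (i.1, k.1, k.2, i.2))
    (codeState N pW pXW)
  have hτ : ∀ s t, τ s t = if s.1 = t.1 then
      (pW s.1 • ∑ x, pXW s.1 x • N.state₂ x) s.2 t.2 else 0 := by
    rintro ⟨w, i⟩ ⟨w', i'⟩
    simp only [τ, partialTrace, of_apply, codeState_apply, Fintype.sum_prod_type]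
    by_cases h : w = w'
    · simp [h, Matrix.sum_apply, Finset.mul_sum, mul_assoc, Channel.state₂, partialTrace]
    · simp [h]
  have htr : ∀ w, ∑ i, (pW w • ∑ x, pXW w x • N.state₂ x) i i = (pW w : ℂ) := fun w => by
    have := (isDensity_sum_smul (hpXW w) N.isDensity₂).2
    simp only [Matrix.smul_apply, ← Finset.smul_sum]
    exact (congrArg (pW w • ·) this).trans (by simp)
  have e1 : partialTrace (fun (i : W) (k : b₂) => (i, k)) τ = diagonal fun w => (pW w : ℂ) := by
    ext w w'
    simp only [partialTrace, of_apply, hτ, diagonal_apply]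
    by_cases h : w = w'
    · simp only [h, if_true, htr]
    · simp [h]
  have e2 : partialTrace (fun (i : b₂) (k : W) => (k, i)) τ
      = ∑ w, pW w • ∑ x, pXW w x • N.state₂ x := by
    ext i i'
    simp only [partialTrace, of_apply, hτ, if_true, Matrix.sum_apply]
  have e3 : τ = (blockDiagonal fun w => pW w • ∑ x, pXW w x • N.state₂ x).submatrix
      (Equiv.prodComm _ _) (Equiv.prodComm _ _) := by
    ext s t
    simp only [hτ, submatrix_apply, Equiv.prodComm_apply, blockDiagonal_apply, Prod.fst_swap,
      Prod.snd_swap]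
  rw [e1, e2, e3, entropy_diagonal, entropy_blockDiagonal _ _ fun w =>
    isDensity_sum_smul (hpXW w) N.isDensity₂]
  ring

omit [DecidableEq b₂] in
theorem infoXB₁_codeState :
    infoXB₁ (codeState N pW pXW)
      = entropy (∑ w, pW w • ∑ x, pXW w x • N.state₁ x)
        - ∑ x, (∑ w, pW w * pXW w x) * entropy (N.state₁ x) := by
  rw [infoXB₁, mutualInfo]
  set τ := partialTrace (fun (i : X × b₁) (k : W × b₂) => (k.1, i.1, i.2, k.2))
    (codeState N pW pXW)
  have hτ : ∀ s t, τ s t = if s.1 = t.1 then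
      ((∑ w, pW w * pXW w s.1) • N.state₁ s.1) s.2 t.2 else 0 := by
    rintro ⟨x, i⟩ ⟨x', i'⟩
    simp only [τ, partialTrace, of_apply, codeState_apply, Fintype.sum_prod_type]
    by_cases h : x = x'
    · simp only [h, and_self, if_true, Matrix.smul_apply, Channel.state₁, partialTrace, of_apply,
        Complex.real_smul, Complex.ofReal_sum, Finset.sum_mul, Finset.mul_sum]
      exact Finset.sum_comm
    · simp [h]
  have e1 : partialTrace (fun (i : X) (k : b₁) => (i, k)) τ
      = diagonal fun x => ((∑ w, pW w * pXW w x : ℝ) : ℂ) := by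
    ext x x'
    simp only [partialTrace, of_apply, hτ, diagonal_apply]
    by_cases h : x = x'
    · simp only [h, if_true, Matrix.smul_apply, Complex.real_smul]
      rw [← Finset.mul_sum, N.sum_state₁_diag, mul_one]
    · simp [h]
  have e2 : partialTrace (fun (i : b₁) (k : X) => (k, i)) τ
      = ∑ w, pW w • ∑ x, pXW w x • N.state₁ x := by
    ext i i'
    simp only [partialTrace, of_apply, hτ, if_true, Matrix.sum_apply, Matrix.smul_apply,
      Finset.smul_sum, Finset.sum_smul, smul_smul]
    exact Finset.sum_comm
  have e3 : τ = (blockDiagonal fun x => (∑ w, pW w * pXW w x) • N.state₁ x).submatrix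
      (Equiv.prodComm _ _) (Equiv.prodComm _ _) := by
    ext s t
    simp only [hτ, submatrix_apply, Equiv.prodComm_apply, blockDiagonal_apply, Prod.fst_swap,
      Prod.snd_swap]
  rw [e1, e2, e3, entropy_diagonal, entropy_blockDiagonal _ _ N.isDensity₁]
  ring

end CQBroadcast
end Information

/-! ### Averaging over the random superposition codebook. -/

section RandomCoding

namespace CQBroadcast

theorem sum_mul_sum_mul_comm {α β : Type*} [Fintype α] [Fintype β] (u : α → ℝ) (v : β → ℝ)
    (g : α → β → ℝ) : ∑ a, u a * ∑ b, v b * g a b = ∑ b, v b * ∑ a, u a * g a b := by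
  simp_rw [Finset.mul_sum]
  rw [Finset.sum_comm]
  simp_rw [mul_left_comm]

/-- Derandomisation: not every value can exceed the mean. -/
theorem exists_le_of_sum_weight_mul_le {α : Type*} [Fintype α] {μ : α → ℝ}
    (hμ : μ ∈ stdSimplex ℝ α) {f : α → ℝ} {c : ℝ} (h : ∑ a, μ a * f a ≤ c) : ∃ a, f a ≤ c := by
  by_contra! hlt
  have h0 : ∑ a, μ a * (f a - c) ≤ 0 := by
    simp_rw [mul_sub, Finset.sum_sub_distrib, ← Finset.sum_mul, hμ.2, one_mul]
    linarith
  have hnn : ∀ a, 0 ≤ μ a * (f a - c) := fun a => mul_nonneg (hμ.1 a) (sub_nonneg.2 (hlt a).le)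
  have hz := (Finset.sum_eq_zero_iff_of_nonneg fun a _ => hnn a).1
    (le_antisymm h0 (Finset.sum_nonneg fun a _ => hnn a))
  have : ∑ a, μ a = 0 := Finset.sum_eq_zero fun a ha =>
    (mul_eq_zero.1 (hz a ha)).resolve_right (sub_pos.2 (hlt a)).ne'
  linarith [hμ.2]

variable {A B ι κ : Type*} [Fintype A] [Fintype B] [Fintype ι] [DecidableEq ι] [Fintype κ]
  [DecidableEq κ] {p : A → ℝ} {q : A → B → ℝ}

/-- Expectation bound for the superposition codebook: `κ` cloud centres, drawn independently
from `p`, and around each of them `ι` satellites, drawn from `q`. -/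
theorem exists_superposition_codebook (hp : p ∈ stdSimplex ℝ A)
    (hq : ∀ a, q a ∈ stdSimplex ℝ B) {F : A → B → ℝ} {G : A → B → B → ℝ} {G' : A → B → A → ℝ}
    {cF c₁ c₂ c₃ : ℝ} (hF : ∑ a, p a * ∑ b, q a b * F a b ≤ cF)
    (h₁ : ∀ a b', ∑ b, q a b * G a b b' ≤ c₁)
    (h₂ : ∀ b', ∑ a, p a * ∑ b, q a b * G a b b' ≤ c₂)
    (h₃ : ∀ a', ∑ a, p a * ∑ b, q a b * G' a b a' ≤ c₃) :
    ∃ r : κ → A × (ι → B), ∑ i, ∑ k, (F (r k).1 ((r k).2 i)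
        + ∑ j ∈ Finset.univ.erase (i, k), G (r k).1 ((r k).2 i) ((r j.2).2 j.1)
        + ∑ l ∈ Finset.univ.erase k, G' (r k).1 ((r k).2 i) (r l).1)
      ≤ Fintype.card ι * Fintype.card κ * (cF + ((Fintype.card ι - 1) * c₁
        + Fintype.card ι * (Fintype.card κ - 1) * c₂) + (Fintype.card κ - 1) * c₃) := by
  have hrow := rowWeight_mem_stdSimplex (ι := ι) hp hq
  -- A cloud centre with all its satellites is treated as one letter, so the codebook is an i.i.d.
  -- sequence of such letters.
  set μ : A × (ι → B) → ℝ := rowWeight p q with hμ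
  refine exists_le_of_sum_weight_mul_le (prod_mem_stdSimplex fun _ : κ => hrow) ?_
  have tF : ∀ i k, ∑ r : κ → A × (ι → B), (∏ l, μ (r l)) * F (r k).1 ((r k).2 i) ≤ cF :=
    fun i k => by
      rw [sum_prod_mul_apply hrow.2 (fun s : A × (ι → B) => F s.1 (s.2 i)) k, hμ,
        sum_rowWeight_mul_apply p hq F i]
      exact hF
  have tG : ∀ i k, ∀ j ∈ Finset.univ.erase (i, k), ∑ r : κ → A × (ι → B),
      (∏ l, μ (r l)) * G (r k).1 ((r k).2 i) ((r j.2).2 j.1) ≤ if j.2 = k then c₁ else c₂ := by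
    rintro i k ⟨i', k'⟩ hj
    split_ifs with hk
    -- Same cloud: the two satellites are independent given their centre. The competitor is held
    -- fixed while the true satellite is averaged.
    · dsimp only at hk
      subst hk
      have hi : i ≠ i' := fun h => (Finset.mem_erase.1 hj).1 (by rw [h])
      rw [sum_prod_mul_apply hrow.2 (fun s : A × (ι → B) => G s.1 (s.2 i) (s.2 i')) k', hμ,
        sum_rowWeight_mul_apply₂ p hq G hi]
      calc ∑ a, p a * ∑ b, q a b * ∑ c, q a c * G a b c
          = ∑ a, p a * ∑ c, q a c * ∑ b, q a b * G a b c :=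
             Finset.sum_congr rfl fun a _ => congrArg _ (sum_mul_sum_mul_comm _ _ _)
        _ ≤ ∑ a, p a * ∑ c, q a c * c₁ := by
            gcongr with a _ c
            exacts [hp.1 a, (hq a).1 c, h₁ a c]
        _ = c₁ := by simp_rw [← Finset.sum_mul, (hq _).2, one_mul, ← Finset.sum_mul, hp.2, one_mul]
    -- Different clouds: the competitor is independent of the true centre and satellite together, so
    -- both are averaged.
    · have hk' : k' ≠ k := hk
      rw [sum_prod_mul_apply₂ hrow.2
        (fun s t : A × (ι → B) => G s.1 (s.2 i) (t.2 i')) (Ne.symm hk')]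
      calc ∑ s, μ s * ∑ t, μ t * G s.1 (s.2 i) (t.2 i')
          = ∑ t, μ t * ∑ s, μ s * G s.1 (s.2 i) (t.2 i') :=
             sum_mul_sum_mul_comm _ _ _
        _ ≤ ∑ t, μ t * c₂ := by
            gcongr with t
            · exact hrow.1 t
            · rw [hμ, sum_rowWeight_mul_apply p hq (fun a b => G a b (t.2 i')) i]
              exact h₂ _
        _ = c₂ := by rw [← Finset.sum_mul, hrow.2, one_mul]
  have tG' : ∀ i k, ∀ l ∈ Finset.univ.erase k, ∑ r : κ → A × (ι → B),
      (∏ l, μ (r l)) * G' (r k).1 ((r k).2 i) (r l).1 ≤ c₃ := by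
    intro i k l hl
    rw [sum_prod_mul_apply₂ hrow.2 (fun s t : A × (ι → B) => G' s.1 (s.2 i) t.1)
      (Finset.mem_erase.1 hl).1.symm]
    calc ∑ s, μ s * ∑ t, μ t * G' s.1 (s.2 i) t.1
        = ∑ t, μ t * ∑ s, μ s * G' s.1 (s.2 i) t.1 :=
           sum_mul_sum_mul_comm _ _ _
      _ ≤ ∑ t, μ t * c₃ := by
          gcongr with t
          · exact hrow.1 t
          · rw [hμ, sum_rowWeight_mul_apply p hq (fun a b => G' a b t.1) i]
            exact h₃ _
      _ = c₃ := by rw [← Finset.sum_mul, hrow.2, one_mul]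
  have cG : ∀ (i : ι) (k : κ), ∑ j ∈ Finset.univ.erase (i, k), (if j.2 = k then c₁ else c₂)
      = (Fintype.card ι - 1) * c₁ + Fintype.card ι * (Fintype.card κ - 1) * c₂ := by
    intro i k
    have h := Finset.add_sum_erase Finset.univ (fun j : ι × κ => if j.2 = k then c₁ else c₂)
      (Finset.mem_univ (i, k))
    have h' : ∑ l : κ, (if l = k then c₁ else c₂) = c₁ + (Fintype.card κ - 1) * c₂ := by
      rw [← Finset.add_sum_erase _ _ (Finset.mem_univ k), if_pos rfl,
        Finset.sum_congr rfl fun l hl => if_neg (Finset.mem_erase.1 hl).1, Finset.sum_const,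
        Finset.card_erase_of_mem (Finset.mem_univ k), nsmul_eq_mul, Finset.card_univ,
        Nat.cast_pred (Fintype.card_pos_iff.2 ⟨k⟩)]
    simp only [if_true, Fintype.sum_prod_type, h', Finset.sum_const, Finset.card_univ,
      nsmul_eq_mul] at h
    linarith
  simp_rw [Finset.mul_sum (s := (Finset.univ : Finset ι)),
    Finset.mul_sum (s := (Finset.univ : Finset κ))]
  rw [Finset.sum_comm]
  simp_rw [Finset.sum_comm (s := (Finset.univ : Finset (κ → A × (ι → B))))]
  refine (Finset.sum_le_sum fun i _ => Finset.sum_le_sum fun k _ => ?_).trans_eq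
    (b := ∑ i : ι, ∑ k : κ, (cF + ((Fintype.card ι - 1) * c₁
        + Fintype.card ι * (Fintype.card κ - 1) * c₂) + (Fintype.card κ - 1) * c₃)) ?_
  · simp_rw [mul_add, Finset.sum_add_distrib]
    refine add_le_add (add_le_add (tF i k) ?_) ?_
    · simp_rw [Finset.mul_sum]
      rw [Finset.sum_comm, ← cG i k]
      exact Finset.sum_le_sum (tG i k)
    · simp_rw [Finset.mul_sum]
      rw [Finset.sum_comm]
      refine (Finset.sum_le_sum (tG' i k)).trans_eq ?_
      rw [Finset.sum_const, Finset.card_erase_of_mem (Finset.mem_univ k), nsmul_eq_mul,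
        Finset.card_univ, Nat.cast_pred (Fintype.card_pos_iff.2 ⟨k⟩)]
  · simp only [Finset.sum_const, Finset.card_univ, nsmul_eq_mul, mul_assoc]

end CQBroadcast
end RandomCoding

/-! ### The one-shot code and its error. -/

section OneShot
open scoped MatrixOrder
open Matrix

namespace CQBroadcast

section Operators

variable {d : Type*} [Fintype d]

theorem conj_le_conj {A B K : Matrix d d ℂ} (h : A ≤ B) : K * A * Kᴴ ≤ K * B * Kᴴ := by
  refine le_of_sub_eq_posSemidef (PosSemidef.mul_mul_conjTranspose_same h K) ?_
  rw [mul_sub, sub_mul]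

variable [DecidableEq d]

theorem conj_smul_one_le {P A : Matrix d d ℂ} (hP : P.IsHermitian) (hP2 : P * P = P) {c : ℝ}
    (hc : 0 ≤ c) (h : A ≤ c • 1) : P * A * Pᴴ ≤ c • 1 := by
  refine (conj_le_conj h).trans ?_
  refine le_of_sub_eq_posSemidef ((posSemidef_one_sub_projection hP hP2).smul hc) ?_
  rw [hP.eq, mul_smul_comm, mul_one, smul_mul_assoc, hP2, smul_sub]

/-- Norm times rank: the cost of one competitor. -/
theorem expect_le_of_le_smul_one {σ S : Matrix d d ℂ} (hS : S.PosSemidef) {c D : ℝ}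
    (hc : 0 ≤ c) (hσ : σ ≤ c • 1) (hD : expect 1 S ≤ D) : expect σ S ≤ c * D := by
  refine (expect_mono_left hS hσ).trans ?_
  rw [expect_comm, expect_smul, expect_comm]
  exact mul_le_mul_of_nonneg_left hD hc

omit [Fintype d] in
theorem IsPOVM.le_one {M : Type*} [Fintype M] {L : M → Matrix d d ℂ} (hL : IsPOVM L) (m : M) :
    L m ≤ 1 := by
  classical
  rw [← hL.2, ← Finset.add_sum_erase _ _ (Finset.mem_univ m)]
  refine le_of_sub_eq_posSemidef (posSemidef_sum (Finset.univ.erase m) fun i _ => hL.1 i) ?_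
  rw [add_sub_cancel_left]

theorem IsTypicalProjection.posSemidef {σ Q : Matrix d d ℂ} {c D : ℝ}
    (h : IsTypicalProjection σ Q c D) : Q.PosSemidef :=
  posSemidef_of_projection h.isHermitian h.mul_self

end Operators

section Kronecker

variable {d e : Type*} [Fintype d] [Fintype e] [DecidableEq d] [DecidableEq e]

omit [DecidableEq d] in
theorem expect_kronecker_one (ρ : Matrix (d × e) (d × e) ℂ) (A : Matrix d d ℂ) :
    expect ρ (A ⊗ₖ (1 : Matrix e e ℂ))
      = expect (partialTrace (fun (i : d) (k : e) => (i, k)) ρ) A := by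
  simp only [expect, trace, diag_apply, mul_apply, kroneckerMap_apply, partialTrace, of_apply,
    Fintype.sum_prod_type, one_apply, mul_ite, mul_one, mul_zero, ite_mul, zero_mul,
    Finset.sum_ite_eq, Finset.mem_univ, if_true, Finset.mul_sum]
  exact congrArg _ (Finset.sum_congr rfl fun i _ => Finset.sum_comm)

omit [DecidableEq e] in
theorem expect_one_kronecker (ρ : Matrix (d × e) (d × e) ℂ) (A : Matrix e e ℂ) :
    expect ρ ((1 : Matrix d d ℂ) ⊗ₖ A)
      = expect (partialTrace (fun (i : e) (k : d) => (k, i)) ρ) A := by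
  simp only [expect, trace, diag_apply, mul_apply, kroneckerMap_apply, partialTrace, of_apply,
    Fintype.sum_prod_type, one_apply, ite_mul, one_mul, zero_mul, Finset.mul_sum]
  rw [Finset.sum_comm]
  congr 1
  refine Finset.sum_congr rfl fun i _ => ?_
  rw [Finset.sum_comm]
  simp_rw [Finset.sum_comm (s := (Finset.univ : Finset d)) (t := (Finset.univ : Finset e))]
  simp

/-- Union bound for two local measurements. -/
theorem expect_one_sub_kronecker_le {ρ : Matrix (d × e) (d × e) ℂ} (hρ : ρ.PosSemidef)
    {A : Matrix d d ℂ} {B : Matrix e e ℂ} (hA : A ≤ 1) (hB : B ≤ 1) :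
    expect ρ (1 - A ⊗ₖ B)
      ≤ expect (partialTrace (fun (i : d) (k : e) => (i, k)) ρ) (1 - A)
        + expect (partialTrace (fun (i : e) (k : d) => (k, i)) ρ) (1 - B) := by
  rw [← expect_kronecker_one, ← expect_one_kronecker, ← expect_add]
  refine expect_mono hρ ?_
  -- The two sides of the union bound differ by exactly `(1 - A) ⊗ (1 - B)`.
  have h := PosSemidef.kronecker (x := 1 - A) (y := 1 - B) hA hB
  refine le_of_sub_eq_posSemidef h ?_
  ext ⟨i, k⟩ ⟨j, l⟩
  have h1 : (1 : Matrix (d × e) (d × e) ℂ) (i, k) (j, l)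
      = (1 : Matrix d d ℂ) i j * (1 : Matrix e e ℂ) k l :=
    (congrFun (congrFun one_kronecker_one (i, k)) (j, l)).symm
  simp only [Matrix.sub_apply, Matrix.add_apply, kroneckerMap_apply, h1]
  ring

end Kronecker

variable {A B ι κ e₁ e₂ : Type*} [Fintype A] [Fintype B] [Fintype ι] [DecidableEq ι]
  [Fintype κ] [DecidableEq κ] [Nonempty ι] [Nonempty κ] [Fintype e₁] [DecidableEq e₁]
  [Fintype e₂] [DecidableEq e₂] {p : A → ℝ} {q : A → B → ℝ}

/-- One-shot superposition coding for a pair of classical-quantum channels `ρ₁`, `ρ₂`. -/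
theorem exists_one_shot_code (hp : p ∈ stdSimplex ℝ A) (hq : ∀ a, q a ∈ stdSimplex ℝ B)
    {ρ₁ : B → Matrix e₁ e₁ ℂ} (hρ₁ : ∀ b, IsDensity (ρ₁ b))
    {ρ₂ : B → Matrix e₂ e₂ ℂ} (hρ₂ : ∀ b, IsDensity (ρ₂ b))
    {σ₁ : A → Matrix e₁ e₁ ℂ} (hσ₁ : ∀ a, σ₁ a = ∑ b, q a b • ρ₁ b)
    {σ₂ : A → Matrix e₂ e₂ ℂ} (hσ₂ : ∀ a, σ₂ a = ∑ b, q a b • ρ₂ b)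
    {τ₁ : Matrix e₁ e₁ ℂ} (hτ₁ : τ₁ = ∑ a, p a • σ₁ a)
    {τ₂ : Matrix e₂ e₂ ℂ} (hτ₂ : τ₂ = ∑ a, p a • σ₂ a)
    {S : B → Matrix e₁ e₁ ℂ} {Q : A → Matrix e₁ e₁ ℂ} {P : Matrix e₁ e₁ ℂ}
    {T : A → Matrix e₂ e₂ ℂ} {P' : Matrix e₂ e₂ ℂ} {c c₁ c₂ c' c₃ D D₁ D₂ D' D₃ ε η : ℝ}
    (hS : ∀ b, IsTypicalProjection (ρ₁ b) (S b) c D)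
    (hQ : ∀ a, IsTypicalProjection (σ₁ a) (Q a) c₁ D₁)
    (hP : IsTypicalProjection τ₁ P c₂ D₂)
    (hT : ∀ a, IsTypicalProjection (σ₂ a) (T a) c' D')
    (hP' : IsTypicalProjection τ₂ P' c₃ D₃)
    (hc₁ : 0 ≤ c₁) (hc₂ : 0 ≤ c₂) (hc₃ : 0 ≤ c₃) (hη : 0 < η)
    (eS : ∑ a, p a * ∑ b, q a b * expect (ρ₁ b) (1 - S b) ≤ ε)
    (eQ : ∑ a, p a * expect (σ₁ a) (1 - Q a) ≤ ε) (eP : expect τ₁ (1 - P) ≤ ε)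
    (eT : ∑ a, p a * expect (σ₂ a) (1 - T a) ≤ ε) (eP' : expect τ₂ (1 - P') ≤ ε) :
    ∃ (x : ι → κ → B) (L : ι × κ → Matrix e₁ e₁ ℂ) (M : κ → Matrix e₂ e₂ ℂ),
      IsPOVM L ∧ IsPOVM M ∧
      ∑ i, ∑ k, (expect (ρ₁ (x i k)) (1 - L (i, k)) + expect (ρ₂ (x i k)) (1 - M k))
        ≤ Fintype.card ι * Fintype.card κ * ((66 * ε + 16 * η)
          + ((Fintype.card ι - 1) * (8 * (c₁ * D))
            + Fintype.card ι * (Fintype.card κ - 1) * (8 * (c₂ * D)))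
          + (Fintype.card κ - 1) * (8 * (c₃ * D'))) := by
  have avg₁ : ∀ a Z, ∑ b, q a b * expect (ρ₁ b) Z = expect (σ₁ a) Z := fun a Z => by
    rw [hσ₁, expect_sum_smul_left]
  have avg₂ : ∀ a Z, ∑ b, q a b * expect (ρ₂ b) Z = expect (σ₂ a) Z := fun a Z => by
    rw [hσ₂, expect_sum_smul_left]
  have avg₃ : ∀ Z, ∑ a, p a * expect (σ₁ a) Z = expect τ₁ Z := fun Z => by
    rw [hτ₁, expect_sum_smul_left]
  have avg₄ : ∀ Z, ∑ a, p a * expect (σ₂ a) Z = expect τ₂ Z := fun Z => by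
    rw [hτ₂, expect_sum_smul_left]
  have hPQ : ∀ a, P * Q a * σ₁ a * (P * Q a)ᴴ = P * (Q a * σ₁ a * Q a) * Pᴴ := fun a => by
    rw [conjTranspose_mul, (hQ a).isHermitian.eq]; simp only [mul_assoc]
  have hPPH : Pᴴ * P = P := by rw [hP.isHermitian.eq, hP.mul_self]
  obtain ⟨r, hr⟩ := exists_superposition_codebook (ι := ι) (κ := κ) hp hq
    (F := fun a b => 8 * expect (ρ₁ b) (1 - S b) + 20 * expect (ρ₁ b) (1 - P)
      + 20 * expect (ρ₁ b) (1 - Q a) + 8 * expect (ρ₂ b) (1 - T a)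
      + 10 * expect (ρ₂ b) (1 - P') + 16 * η)
    (G := fun a b b' => 8 * expect (P * Q a * ρ₁ b * (P * Q a)ᴴ) (S b'))
    (G' := fun _ b a' => 8 * expect (P' * ρ₂ b * P'ᴴ) (T a'))
    -- 66 = 8 + 20 + 20 + 8 + 10, the coefficients in `F`. The defect of `P Q` splits in two with a
    -- factor 2, hence 20 twice; that of the single projection `P'` is just `1 - P'`, hence 10.
    (cF := 66 * ε + 16 * η) (c₁ := 8 * (c₁ * D)) (c₂ := 8 * (c₂ * D)) (c₃ := 8 * (c₃ * D'))
    (by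
      simp only [mul_add, mul_left_comm (q _ _), Finset.sum_add_distrib, ← Finset.mul_sum,
        avg₁, avg₂, ← Finset.sum_mul, (hq _).2, one_mul, mul_left_comm (p _), avg₃, avg₄, hp.2]
      linarith)
    (fun a b' => by
      simp only [mul_left_comm (q _ _), ← Finset.mul_sum, expect_conj, avg₁]
      rw [← expect_conj, hPQ]
      have := expect_le_of_le_smul_one (hS b').posSemidef hc₁
        (conj_smul_one_le hP.isHermitian hP.mul_self hc₁ (hQ a).conj_le_smul) (hS b').trace_le
      linarith)
    (fun b' => by
      simp only [mul_left_comm (q _ _), ← Finset.mul_sum, expect_conj, avg₁, mul_left_comm (p _)]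
      -- `P` stands outside `Q` in `K`, so `Q σ Q ≤ σ` can be applied under the conjugation by `P`.
      -- After this nothing but `σ` depends on the cloud.
      have h1 : ∀ a, expect (σ₁ a) ((P * Q a)ᴴ * S b' * (P * Q a))
          ≤ expect (σ₁ a) (Pᴴ * S b' * P) := fun a => by
        rw [← expect_conj, hPQ, ← expect_conj]
        exact expect_mono_left (hS b').posSemidef (conj_le_conj (hQ a).conj_le)
      have h2 : ∑ a, p a * expect (σ₁ a) ((P * Q a)ᴴ * S b' * (P * Q a))
          ≤ expect (P * τ₁ * Pᴴ) (S b') := by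
        rw [expect_conj, ← avg₃]
        exact Finset.sum_le_sum fun a _ => mul_le_mul_of_nonneg_left (h1 a) (hp.1 a)
      have h3 := expect_le_of_le_smul_one (hS b').posSemidef hc₂
        (show P * τ₁ * Pᴴ ≤ c₂ • 1 by rw [hP.isHermitian.eq]; exact hP.conj_le_smul)
        (hS b').trace_le
      linarith)
    (fun a' => by
      simp only [mul_left_comm (q _ _), ← Finset.mul_sum, expect_conj, avg₂, mul_left_comm (p _),
        avg₄]
      rw [← expect_conj, hP'.isHermitian.eq]
      have := expect_le_of_le_smul_one (hT a').posSemidef hc₃ hP'.conj_le_smul (hT a').trace_le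
      linarith)
  obtain ⟨L, hL, hLe⟩ := exists_povm_of_projections
    (fun j : ι × κ => S ((r j.2).2 j.1)) (fun _ => (hS _).isHermitian)
    (fun _ => (hS _).mul_self) hη
  obtain ⟨M, hM, hMe⟩ := exists_povm_of_projections
    (fun k : κ => T (r k).1) (fun _ => (hT _).isHermitian) (fun _ => (hT _).mul_self) hη
  refine ⟨fun i k => (r k).2 i, L, M, hL, hM, le_trans ?_ hr⟩
  refine Finset.sum_le_sum fun i _ => Finset.sum_le_sum fun k _ => ?_
  have one₁ : ∀ b, expect (ρ₁ b) 1 = 1 := fun b => by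
    rw [expect, one_mul, (hρ₁ b).2, Complex.one_re]
  have one₂ : ∀ b, expect (ρ₂ b) 1 = 1 := fun b => by
    rw [expect, one_mul, (hρ₂ b).2, Complex.one_re]
  have hP1 : P ≤ 1 := posSemidef_one_sub_projection hP.isHermitian hP.mul_self
  have hK : (P * Q (r k).1)ᴴ * (P * Q (r k).1) ≤ 1 := by
    have h1 := conj_smul_one_le (hQ (r k).1).isHermitian (hQ (r k).1).mul_self zero_le_one
      (show P ≤ (1 : ℝ) • 1 by rwa [one_smul])
    rw [one_smul, (hQ _).isHermitian.eq] at h1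
    rwa [conjTranspose_mul, (hQ _).isHermitian.eq, mul_assoc, ← mul_assoc Pᴴ, hPPH, ← mul_assoc]
  have hK' : P'ᴴ * P' ≤ 1 := by
    rw [hP'.isHermitian.eq, hP'.mul_self]
    exact posSemidef_one_sub_projection hP'.isHermitian hP'.mul_self
  have h1 := expect_error_le (hρ₁ ((r k).2 i)).1 (one₁ _) (hS _).isHermitian (hS _).mul_self
    (hL.1 (i, k)) (hL.le_one _) hη.le hK (hLe (i, k))
  have h2 := expect_error_le (hρ₂ ((r k).2 i)).1 (one₂ _) (hT _).isHermitian (hT _).mul_self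
    (hM.1 k) (hM.le_one _) hη.le hK' (hMe k)
  have h3 := expect_smoothing_defect_le (hρ₁ ((r k).2 i)).1 hP.isHermitian hP.mul_self
    (hQ (r k).1).isHermitian (hQ _).mul_self
  have h4 : (1 - P')ᴴ * (1 - P') = 1 - P' := by
    rw [conjTranspose_sub, conjTranspose_one, hP'.isHermitian.eq, projection_one_sub hP'.mul_self]
  rw [expect_sum] at h1 h2
  rw [h4] at h2
  simp only [← Finset.mul_sum]
  linarith

end CQBroadcast
end OneShot

/-! ### Block codes, rates and the final estimate. -/

section Superposition
open scoped MatrixOrder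
open Matrix

namespace CQBroadcast

theorem eventually_exists_typical_projection {b : Type*} [Fintype b] [DecidableEq b]
    {σ : Matrix b b ℂ} (hσ : IsDensity σ) {ε δ : ℝ} (hε : 0 < ε) (hδ : 0 < δ) :
    ∀ᶠ n : ℕ in Filter.atTop, ∃ Q : Matrix (Fin n → b) (Fin n → b) ℂ,
      IsTypicalProjection (tens fun _ : Fin n => σ) Q ((2 : ℝ) ^ (-(n * (entropy σ - δ))))
        ((2 : ℝ) ^ (n * (entropy σ + δ))) ∧
      expect (tens fun _ : Fin n => σ) (1 - Q) ≤ ε := by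
  filter_upwards [eventually_exists_typical_projections (α := Unit) (p := fun _ => 1)
    ⟨fun _ => zero_le_one, by simp⟩ (fun _ => hσ) hε hδ] with n ⟨Q, hQ, hQe⟩
  refine ⟨Q default, by simpa using hQ default, ?_⟩
  simpa using hQe

theorem numMessages_pos (n : ℕ) (R : ℝ) : 0 < numMessages n R :=
  Nat.ceil_pos.2 (by positivity)

/-- Rounding up is absorbed by not counting the true message. The bound stays valid at negative
rates. -/
theorem numMessages_sub_one_le (n : ℕ) (R : ℝ) : (numMessages n R : ℝ) - 1 ≤ 2 ^ (n * R) := by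
  have := Nat.ceil_lt_add_one (a := (2 : ℝ) ^ (n * R)) (by positivity)
  rw [numMessages]
  linarith

theorem numMessages_eq_one {n : ℕ} {R : ℝ} (hR : R ≤ 0) : numMessages n R = 1 := by
  have h : (2 : ℝ) ^ (n * R) ≤ 1 :=
    Real.rpow_le_one_of_one_le_of_nonpos one_le_two
      (mul_nonpos_of_nonneg_of_nonpos n.cast_nonneg hR)
  exact le_antisymm (Nat.ceil_le.2 (by exact_mod_cast h)) (numMessages_pos n R)

section Output

variable {X b₁ b₂ : Type*} [Fintype b₁] [Fintype b₂] (N : Channel X b₁ b₂) {n : ℕ}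

theorem Channel.posSemidef_output (x : Fin n → X) : (N.output x).PosSemidef :=
  (isDensity_tens fun k => N.isDensity (x k)).1.submatrix
    fun i : (Fin n → b₁) × (Fin n → b₂) => fun k => (i.1 k, i.2 k)

theorem Channel.partialTrace_output_snd (x : Fin n → X) :
    partialTrace (fun (i : Fin n → b₁) (k : Fin n → b₂) => (i, k)) (N.output x)
      = tens fun k => N.state₁ (x k) := by
  ext i j
  exact sum_pi_prod fun k e => N.state (x k) (i k, e) (j k, e)

theorem Channel.partialTrace_output_fst (x : Fin n → X) :
    partialTrace (fun (i : Fin n → b₂) (k : Fin n → b₁) => (k, i)) (N.output x)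
      = tens fun k => N.state₂ (x k) := by
  ext i j
  exact sum_pi_prod fun k e => N.state (x k) (e, i k) (e, j k)

variable [DecidableEq b₁] [DecidableEq b₂]

theorem Channel.exists_code_of_local_error {M₁ M : ℕ} (hM₁ : 0 < M₁) (hM : 0 < M)
    {x : Fin M₁ → Fin M → Fin n → X} {L : Fin M₁ × Fin M → Matrix (Fin n → b₁) (Fin n → b₁) ℂ}
    {Γ : Fin M → Matrix (Fin n → b₂) (Fin n → b₂) ℂ} (hL : IsPOVM L) (hΓ : IsPOVM Γ) {c : ℝ}
    (h : ∑ i, ∑ k, (expect (tens fun l => N.state₁ (x i k l)) (1 - L (i, k))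
      + expect (tens fun l => N.state₂ (x i k l)) (1 - Γ k)) ≤ M₁ * M * c) :
    ∃ C : Code X b₁ b₂ n M₁ M 1, C.avgError N ≤ c := by
  -- Receiver 2 has a single personal message, so its second index is ignored.
  refine ⟨⟨fun i k _ => x i k, L, fun j => Γ j.1, hL, fun j => hΓ.1 j.1, ?_⟩, ?_⟩
  · rw [Fintype.sum_prod_type]
    simpa using hΓ.2
  · have hpos : (0 : ℝ) < M₁ * M := by positivity
    rw [Code.avgError, Nat.cast_one, mul_one, div_le_iff₀ hpos, mul_comm c]
    refine le_trans (Finset.sum_le_sum fun i _ => Finset.sum_le_sum fun k _ => ?_) h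
    rw [Fintype.sum_unique, ← N.partialTrace_output_snd, ← N.partialTrace_output_fst]
    exact expect_one_sub_kronecker_le (N.posSemidef_output _) (hL.le_one _) (hΓ.le_one _)

end Output

/-- The rate margin `δ` exceeds the two typicality losses of `δ / 4` by `δ / 2`. -/
theorem competitor_bound {K R H H' s δ : ℝ} {n : ℕ} (hK : K ≤ 2 ^ (n * (R - δ)))
    (hR : R ≤ H - H') (hs : s = -(n * (δ / 2))) :
    K * ((2 : ℝ) ^ (-(n * (H - δ / 4))) * 2 ^ (n * (H' + δ / 4))) ≤ 2 ^ s := by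
  refine (mul_le_mul_of_nonneg_right hK (by positivity)).trans ?_
  rw [← Real.rpow_add two_pos, ← Real.rpow_add two_pos]
  refine Real.rpow_le_rpow_of_exponent_le one_le_two ?_
  have : (n : ℝ) * R ≤ n * (H - H') := mul_le_mul_of_nonneg_left hR n.cast_nonneg
  rw [hs]
  nlinarith

theorem tendsto_two_rpow_neg_mul {δ : ℝ} (hδ : 0 < δ) :
    Filter.Tendsto (fun n : ℕ => (2 : ℝ) ^ (-(n * δ))) Filter.atTop (nhds 0) := by
  have h : ∀ n : ℕ, (2 : ℝ) ^ (-(n * δ)) = ((2 : ℝ) ^ (-δ)) ^ n := fun n => by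
    rw [← Real.rpow_natCast, ← Real.rpow_mul two_pos.le]
    ring_nf
  simp_rw [h]
  exact tendsto_pow_atTop_nhds_zero_of_lt_one (by positivity)
    (Real.rpow_lt_one_of_one_lt_of_neg one_lt_two (neg_lt_zero.2 hδ))

end CQBroadcast
end Superposition

open CQBroadcast in
theorem mainTheorem6 {W X b₁ b₂ : Type*} [Fintype W] [DecidableEq W] [Fintype X] [DecidableEq X]
    [Fintype b₁] [DecidableEq b₁] [Fintype b₂] [DecidableEq b₂]
    (N : CQBroadcast.Channel X b₁ b₂)
    (pW : W → ℝ) (hpW : pW ∈ stdSimplex ℝ W)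
    (pXW : W → X → ℝ) (hpXW : ∀ w, pXW w ∈ stdSimplex ℝ X)
    (R₁ R : ℝ) (hR₁ : 0 ≤ R₁) (hR : 0 ≤ R)
    (h₁ : R₁ ≤ CQBroadcast.infoXB₁W (CQBroadcast.codeState N pW pXW))
    (h₂ : R ≤ CQBroadcast.infoWB₂ (CQBroadcast.codeState N pW pXW))
    (h₃ : R₁ + R ≤ CQBroadcast.infoXB₁ (CQBroadcast.codeState N pW pXW)) :
    N.Achievable R₁ R 0 := by
  rw [infoXB₁W_codeState N hpXW] at h₁
  rw [infoWB₂_codeState N hpXW] at h₂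
  rw [infoXB₁_codeState N] at h₃
  intro ε hε δ hδ
  set σ₁ : W → Matrix b₁ b₁ ℂ := fun w => ∑ x, pXW w x • N.state₁ x with hσ₁
  set σ₂ : W → Matrix b₂ b₂ ℂ := fun w => ∑ x, pXW w x • N.state₂ x with hσ₂
  set pX : X → ℝ := fun x => ∑ w, pW w * pXW w x with hpX_def
  have hpX : pX ∈ stdSimplex ℝ X := by
    refine ⟨fun x => Finset.sum_nonneg fun w _ => mul_nonneg (hpW.1 w) ((hpXW w).1 x), ?_⟩
    rw [hpX_def, Finset.sum_comm]
    simp_rw [← Finset.mul_sum, (hpXW _).2, mul_one, hpW.2]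
  have hS_eq : ∑ w, pW w * ∑ x, pXW w x * entropy (N.state₁ x)
      = ∑ x, pX x * entropy (N.state₁ x) := by
    simp_rw [hpX_def, Finset.sum_mul, Finset.mul_sum, mul_assoc]
    exact Finset.sum_comm
  rw [hS_eq] at h₁
  have dσ₁ : ∀ w, IsDensity (σ₁ w) := fun w => isDensity_sum_smul (hpXW w) N.isDensity₁
  have dσ₂ : ∀ w, IsDensity (σ₂ w) := fun w => isDensity_sum_smul (hpXW w) N.isDensity₂
  have hε' : 0 < ε / 200 := by positivity
  have hδ' : 0 < δ / 4 := by positivity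
  filter_upwards [eventually_exists_typical_projections hpX N.isDensity₁ hε' hδ',
    eventually_exists_typical_projections hpW dσ₁ hε' hδ',
    eventually_exists_typical_projections hpW dσ₂ hε' hδ',
    eventually_exists_typical_projection (isDensity_sum_smul hpW dσ₁) hε' hδ',
    eventually_exists_typical_projection (isDensity_sum_smul hpW dσ₂) hε' hδ',
    (tendsto_two_rpow_neg_mul (half_pos hδ)).eventually_lt_const
      (show (0 : ℝ) < ε / 64 by positivity)]
    with n ⟨S, hS, eS⟩ ⟨Q, hQ, eQ⟩ ⟨T, hT, eT⟩ ⟨P, hP, eP⟩ ⟨P', hP', eP'⟩ hn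
  rw [numMessages_eq_one (n := n) (R := 0 - δ) (by linarith)]
  have hM₁ := numMessages_pos n (R₁ - δ)
  have hM := numMessages_pos n (R - δ)
  have hM₁' := numMessages_sub_one_le n (R₁ - δ)
  have hM' := numMessages_sub_one_le n (R - δ)
  generalize numMessages n (R₁ - δ) = M₁ at *
  generalize numMessages n (R - δ) = M at *
  have : Nonempty (Fin M₁) := ⟨⟨0, hM₁⟩⟩
  have : Nonempty (Fin M) := ⟨⟨0, hM⟩⟩
  -- The satellite marginal of the superposition law is the product of `pX`, for which `S` was
  -- chosen.
  have eS' : ∑ w : Fin n → W, (∏ k, pW (w k)) * ∑ x : Fin n → X, (∏ k, pXW (w k) (x k)) *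
      expect (tens fun k => N.state₁ (x k)) (1 - S x) ≤ ε / 200 := by
    refine le_of_eq_of_le ?_ eS
    simp_rw [Finset.mul_sum]
    rw [Finset.sum_comm]
    refine Finset.sum_congr rfl fun x _ => ?_
    simp_rw [← mul_assoc, ← Finset.sum_mul, ← Finset.prod_mul_distrib]
    rw [sum_pi_prod fun k w => pW w * pXW w (x k)]
  obtain ⟨x, L, Γ, hL, hΓ, hbound⟩ := exists_one_shot_code (ι := Fin M₁) (κ := Fin M)
    (A := Fin n → W) (B := Fin n → X) (p := fun w => ∏ k, pW (w k))
    (q := fun w x => ∏ k, pXW (w k) (x k))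
    (prod_mem_stdSimplex fun _ => hpW) (fun w => prod_mem_stdSimplex fun k => hpXW (w k))
    (ρ₁ := fun x => tens fun k => N.state₁ (x k)) (fun x => isDensity_tens fun k => N.isDensity₁ _)
    (ρ₂ := fun x => tens fun k => N.state₂ (x k)) (fun x => isDensity_tens fun k => N.isDensity₂ _)
    (σ₁ := fun w => tens fun k => σ₁ (w k))
    (fun w => (sum_smul_tens (fun k => pXW (w k)) fun _ => N.state₁).symm)
    (σ₂ := fun w => tens fun k => σ₂ (w k))
    (fun w => (sum_smul_tens (fun k => pXW (w k)) fun _ => N.state₂).symm)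
    (sum_smul_tens (fun _ => pW) fun _ => σ₁).symm
    (sum_smul_tens (fun _ => pW) fun _ => σ₂).symm
    -- The regularisation parameter `η` is also taken to be `ε / 200`.
    hS hQ hP hT hP' (by positivity) (by positivity) (by positivity) hε' eS' eQ eP eT eP'
  rw [Fintype.card_fin, Fintype.card_fin] at hbound
  obtain ⟨C, hC⟩ := N.exists_code_of_local_error hM₁ hM hL hΓ hbound
  refine ⟨C, hC.trans ?_⟩
  have hc₁ := competitor_bound hM₁' h₁ (s := -(n * (δ / 2))) rfl
  have hc₂ := competitor_bound hM' h₂ (s := -(n * (δ / 2))) rfl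
  -- Competitors in other clouds are counted as `M₁ (M - 1) = (M₁ - 1)(M - 1) + (M - 1)`. The second
  -- summand is treated here, by `R ≤ R₁ + R`, and the first in `hc₄`. Bounding each factor less one
  -- avoids trouble when `R₁ < δ` or `R < δ`.
  have hc₃ := competitor_bound hM' (show R ≤ _ from le_trans (by linarith) h₃)
    (s := -(n * (δ / 2))) rfl
  have hMM : ((M₁ : ℝ) - 1) * (M - 1) ≤ 2 ^ (n * ((R₁ + R) - δ)) := by
    refine (mul_le_mul hM₁' hM' (sub_nonneg.2 (by exact_mod_cast hM)) (by positivity)).trans ?_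
    rw [← Real.rpow_add two_pos]
    refine Real.rpow_le_rpow_of_exponent_le one_le_two ?_
    nlinarith [mul_nonneg (Nat.cast_nonneg (α := ℝ) n) hδ.le]
  have hc₄ := competitor_bound hMM h₃ (s := -(n * (δ / 2))) rfl
  -- Budget: `(66 + 16) ε / 200` plus four competitor terms of at most `8 · ε / 64` each, in total
  -- below `ε`.
  linarith
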